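/- Let $C\ge 3$ and $m>C$ be integers, let $(\mathcal X,\mathcal A_{\mathcal X})$ be a measurable space, let the set of categories $\{1,\dots,C\}$ carry the discrete $\sigma$-algebra, and let $P$ be a probability measure on $\mathcal X\times\{1,\dots,C\}$. Let $M_{\mathcal G}\in[1,\infty)$ and $\mathcal G=\prod_{k=1}^C\mathcal G_k$, where each $\mathcal G_k$ is a class of functions from $\mathcal X$ to $[-M_{\mathcal G},M_{\mathcal G}]$ which is a uniform Glivenko–Cantelli class: its elements are measurable and, for every $\epsilon>0$, $$\lim_{n\to\infty}\ \sup_{Q}\ Q^{\infty}\Big(\sup_{n'\ge n}\ \sup_{f\in\mathcal G_k}\Big|\frac1{n'}\sum_{i=1}^{n'}f(T_i)-\mathbb E_{T\sim Q}f(T)\Big|>\epsilon\Big)=0,$$ $Q$ ranging over all probability measures on $\mathcal X$ and $T_1,T_2,\dots$ denoting the coordinates under $Q^\infty$. For $\epsilon>0$, let $\epsilon\text{-dim}(\mathcal G_k)$ be the fat-shattering dimension, i.e. the maximal cardinality $n$ of a nonempty set $\{t_1,\dots,t_n\}\subset\mathcal X$ for which there is $b\in[-M_{\mathcal G},M_{\mathcal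 G}]^n$ such that for every $l\in\{-1,1\}^n$ some $f\in\mathcal G_k$ satisfies $l_i(f(t_i)-b_i)\ge\epsilon$ for all $i$ (it is $\infty$ if such cardinalities are unbounded and $0$ if there is no such set). Assume that there are an integer $d_{\mathcal G}\ge1$ and a real $K_{\mathcal G}>0$ such that $$\forall\epsilon\in(0,M_{\mathcal G}],\qquad \max_{1\le k\le C}\epsilon\text{-dim}(\mathcal G_k)\le K_{\mathcal G}\,\epsilon^{-d_{\mathcal G}}.$$ Let $\gamma\in(0,1]$, $\pi_\gamma(t)=t\,\mathbf 1_{\{t\in(0,\gamma]\}}+\gamma\,\mathbf 1_{\{t>\gamma\}}$, and for $g=(g_k)_k\in\mathcal G$ let $f_g(x,k)=\frac12\big(g_k(x)-\max_{l\ne k}g_l(x)\big)$. Put $\mathcal F_{\mathcal G,\gamma}=\{\pi_\gamma\circ f_g:\ g\in\mathcal G\}$ and let $$R_m(\mathcal F_{\mathcal G,\gamma})=\mathbb E\Big[\sup_{f\in\mathcal F_{\mathcal G,\gamma}}\frac1m\sum_{i=1}^m\sigma_if(Z_i)\Big]$$ be its Rademacher complexity, where $Z_1,\dots,Z_m$ are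 i.i.d. of law $P$ and $\sigma_1,\dots,\sigma_m$ are independent uniform random signs, independent of the $Z_i$; the expectation of the supremum is understood as the supremum, over finite nonempty subsets of $\mathcal F_{\mathcal G,\gamma}$, of the expectation of the maximum. 1. If $d_{\mathcal G}=1$, then, with $F(C)=2\sqrt{\frac{14M_{\mathcal G}}{\gamma}}\,C^{1/4}$ and $\operatorname{erf}(t)=\frac2{\sqrt\pi}\int_0^te^{-u^2}\,du$, $$R_m(\mathcal F_{\mathcal G,\gamma})\le160\sqrt{\frac{30K_{\mathcal G}\gamma}{m}}\,C^{3/4}\left[\sqrt{\frac{\ln F(C)}2}+\sqrt{\frac\pi8}\,F(C)\Big(1-\operatorname{erf}\big(\sqrt{\ln F(C)}\big)\Big)\right].$$ 2. If $d_{\mathcal G}=2$, then $$R_m(\mathcal F_{\mathcal G,\gamma})\le\frac{\gamma C^{3/4}}{\sqrt m}+1152\sqrt{\frac{5K_{\mathcal G}}m}\;C\left\lceil\tfrac12\log_2\tfrac mC\right\rceil\sqrt{\ln\left(\frac{14M_{\mathcal G}\sqrt m}{\gamma C^{1/4}}\right)}.$$ 3. If $d_{\mathcal G}>2$, then $$R_m(\mathcal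 F_{\mathcal G,\gamma})\le\sqrt C\left(\gamma\Big(\frac Cm\Big)^{\frac1{d_{\mathcal G}}}+8\cdot96^{\frac{d_{\mathcal G}}2}\Big(2^{\frac2{d_{\mathcal G}-2}}+1\Big)\gamma^{1-\frac{d_{\mathcal G}}2}\sqrt{5K_{\mathcal G}}\,\Big(\frac Cm\Big)^{\frac1{d_{\mathcal G}}}\sqrt{\ln\left(\frac{14M_{\mathcal G}}\gamma\Big(\frac mC\Big)^{\frac1{d_{\mathcal G}}}\right)}\right).$$ -/

import Mathlib

open MeasureTheory Filter Topology
open scoped ENNReal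

namespace MarginClassifier

/-- A class `F` of measurable functions is a uniform Glivenko-Cantelli class if, for every `ε > 0`,
`sup_P ℙ (sup_{n' ≥ n} sup_{f ∈ F} |P_{n'} f - P f| > ε) → 0` as `n → ∞`, where `P` ranges over all
probability measures on the domain, `ℙ = P^∞` is the infinite product measure and `P_{n'}` is the
empirical measure of the first `n'` sample points. -/
def IsUniformGC {T : Type*} [MeasurableSpace T] (F : Set (T → ℝ)) : Prop :=
  (∀ f ∈ F, Measurable f) ∧
  ∀ ε : ℝ, 0 < ε →
    Tendsto
      (fun n : ℕ => ⨆ P : ProbabilityMeasure T,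
        Measure.infinitePi (fun _ : ℕ => (P : Measure T))
          {t : ℕ → T | ∃ n' : ℕ, n ≤ n' ∧ ∃ f ∈ F,
            ε < |(1 / (n' : ℝ)) * ∑ i ∈ Finset.range n', f (t i) - ∫ x, f x ∂(P : Measure T)|})
      atTop (𝓝 0)

/-- The requirements on the component classes `G k` (`k` ranging over the `C` categories) of a
class of margin multi-category classifiers: `M ∈ [1, ∞)`, all component functions take their values
in `[-M, M]`, and each component class is a uniform Glivenko-Cantelli class. -/
structure IsMarginClass {X : Type*} [MeasurableSpace X] {C : ℕ} (M : ℝ)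
    (G : Fin C → Set (X → ℝ)) : Prop where
  one_le : 1 ≤ M
  mem_Icc : ∀ k, ∀ f ∈ G k, ∀ x, f x ∈ Set.Icc (-M) M
  uniformGC : ∀ k, IsUniformGC (G k)

/-- The class `𝒢 = ∏ₖ G k` of vector-valued functions `g = (g k)ₖ`. -/
def productClass {X : Type*} {C : ℕ} (G : Fin C → Set (X → ℝ)) : Set (Fin C → X → ℝ) :=
  {g | ∀ k, g k ∈ G k}

/-- `f_g (x, k) = (g_k x - max_{l ≠ k} g_l x) / 2`. -/
noncomputable def marginFun {X : Type*} {C : ℕ} (g : Fin C → X → ℝ) : X × Fin C → ℝ :=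
  fun z => (1 / 2) * (g z.2 z.1 - ⨆ l : {l : Fin C // l ≠ z.2}, g l z.1)

/-- The piecewise-linear squashing function `π_γ (t) = t 1_{t ∈ (0, γ]} + γ 1_{t > γ}`. -/
noncomputable def squash (γ : ℝ) (t : ℝ) : ℝ :=
  (if 0 < t ∧ t ≤ γ then t else 0) + (if γ < t then γ else 0)

/-- The class `F_{𝒢, γ} = {π_γ ∘ f_g : g ∈ 𝒢}`. -/
def squashedMarginClass {X : Type*} {C : ℕ} (G : Fin C → Set (X → ℝ)) (γ : ℝ) :
    Set (X × Fin C → ℝ) :=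
  {f | ∃ g ∈ productClass G, f = squash γ ∘ marginFun g}

/-- The Rademacher complexity `R_n (F) = 𝔼 [sup_{f ∈ F} (1/n) ∑ᵢ σᵢ f (Tᵢ)]`, where `T₁, …, Tₙ` are
i.i.d. of law `P` and `σ₁, …, σₙ` are independent uniform random signs, independent of the sample
(the expectation over the signs is the average over all `2 ^ n` sign vectors). As usual for a
possibly uncountable index set, the expected supremum of the process is the supremum, over the
finite nonempty subsets `S` of `F`, of the expected maximum over `S`. -/
noncomputable def rademacherComplexity {T : Type*} [MeasurableSpace T] (P : Measure T) (n : ℕ)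
    (F : Set (T → ℝ)) : EReal :=
  ⨆ (S : Finset (T → ℝ)) (hS : S.Nonempty) (_ : (S : Set (T → ℝ)) ⊆ F),
    ((∫ t : Fin n → T,
        (1 / (2 : ℝ) ^ n) * ∑ σ : Fin n → ℤˣ,
          S.sup' hS (fun f => (1 / (n : ℝ)) * ∑ i, (((σ i : ℤˣ) : ℤ) : ℝ) * f (t i))
      ∂(Measure.pi fun _ : Fin n => P) : ℝ) : EReal)

/-- The finite set `s` is `γ`-shattered by the class `F` of functions with values in `S`. -/
def IsFatShattered {T : Type*} (S : Set ℝ) (F : Set (T → ℝ)) (γ : ℝ) (s : Finset T) : Prop :=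
  ∃ b : T → ℝ, (∀ t ∈ s, b t ∈ S) ∧
    ∀ l : T → ℤˣ, ∃ f ∈ F, ∀ t ∈ s, γ ≤ (((l t : ℤˣ) : ℤ) : ℝ) * (f t - b t)

/-- The fat-shattering dimension with margin `γ` of a class `F` of functions with values in `S`:
the maximal cardinality of a nonempty `γ`-shattered finite set, infinite if these cardinalities are
unbounded, and `0` if no nonempty set is `γ`-shattered. -/
noncomputable def fatDim {T : Type*} (S : Set ℝ) (F : Set (T → ℝ)) (γ : ℝ) : ℕ∞ :=
  ⨆ (s : Finset T) (_ : s.Nonempty ∧ IsFatShattered S F γ s), (s.card : ℕ∞)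

/-- The error function `erf t = (2 / √π) ∫_0^t exp (-u²) du`. -/
noncomputable def erf (t : ℝ) : ℝ :=
  (2 / Real.sqrt Real.pi) * ∫ u in (0 : ℝ)..t, Real.exp (-u ^ 2)

/-- `F(C) = 2 √(14 M / γ) C^{1/4}`. -/
noncomputable def boundF (M γ : ℝ) (C : ℕ) : ℝ :=
  2 * Real.sqrt (14 * M / γ) * (C : ℝ) ^ ((1 : ℝ) / 4)

end MarginClassifier

/-! The bounds come from chaining in the empirical L² norm, fed by an entropy estimate that does not
depend on the sample size.

The entropy estimate follows Mendelson and Vershynin. Let a finite class be separated by `ε` in the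
L² norm of `n` sample points. Random extraction of coordinates (`exists_separating_coordinates`)
keeps the separation, up to a factor 2, on a number of points of order `(M / ε)² log |A|`. On few
points, `card_le_sq_card_gapShattered` shows that the class shatters at least `√|A|` sets of pairs
(point, level). The reason is that some coordinate has a large variance, so a small deviation
principle splits the class there into two subclasses separated by a gap. The split is balanced
enough for `√|A|` to be subadditive, while the numbers of shattered sets add up. A shattered set of
pairs is a fat-shattered set of points at scale `ε / 96`, so the fat-shattering dimension `V` bounds
its size. Counting small subsets of the grid gives `√|A| ≤ (eQ / V)^V` with `Q` of order `(M / ε)³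
log |A|`; solving for `log |A|` gives `20 V log (14 M / ε)`. A maximal separated set is a net.

The map from `g` to the squashed margin function is 1-Lipschitz for the maximum over the categories.
Hence products of nets at scale `h / √C` are nets at scale `h`, and the log-cardinalities add up to
a factor `C`.

Chaining with Massart's lemma bounds the complexity by a sum over scales. With dimension `K ε^(-d)`
the term at scale `h` behaves like `h^(1 - d/2)` up to the logarithm. For `d = 1` the scales `γ /
4^j` give a convergent series, compared with an integral that `erf` evaluates. For `d = 2` all terms
are of the same order and their number is the ceiling factor. For `d > 2` the finest scale dominates
and is balanced against the approximation error. -/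

namespace MarginClassifier

/-! ### Shattering with a gap -/

/-- The finite set `S` of pairs (point, level) is shattered by `B` with half-gap `θ`, the level `a`
standing for the real number `η * a`. -/
def GapShatters {T : Type*} (η θ : ℝ) (B : Finset (T → ℝ)) (S : Finset (T × ℤ)) : Prop :=
  ∀ U ⊆ S, ∃ f ∈ B, (∀ s ∈ U, η * s.2 + θ ≤ f s.1) ∧ ∀ s ∈ S, s ∉ U → f s.1 ≤ η * s.2 - θ

open Classical in
/-- The subsets of `W` shattered by `B` with half-gap `θ`. -/
noncomputable def gapShattered {T : Type*} (η θ : ℝ) (B : Finset (T → ℝ)) (W : Finset (T × ℤ)) :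
    Finset (Finset (T × ℤ)) :=
  W.powerset.filter (GapShatters η θ B)

theorem GapShatters.mono {T : Type*} {η θ : ℝ} {B₁ B : Finset (T → ℝ)} (h : B₁ ⊆ B)
    {S : Finset (T × ℤ)} (hS : GapShatters η θ B₁ S) : GapShatters η θ B S := fun U hU => by
  obtain ⟨f, hf, h'⟩ := hS U hU
  exact ⟨f, h hf, h'⟩

theorem mem_gapShattered {T : Type*} {η θ : ℝ} {B : Finset (T → ℝ)} {W : Finset (T × ℤ)}
    {S : Finset (T × ℤ)} : S ∈ gapShattered η θ B W ↔ S ⊆ W ∧ GapShatters η θ B S := by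
  classical
  simp [gapShattered]

theorem GapShatters.notMem_of_le {T : Type*} {η θ : ℝ} (hθ : 0 < θ) {B : Finset (T → ℝ)}
    {S : Finset (T × ℤ)} (hS : GapShatters η θ B S) {w : T × ℤ}
    (hw : ∀ f ∈ B, η * w.2 + θ ≤ f w.1) : w ∉ S := fun hwS => by
  obtain ⟨f, hf, -, h⟩ := hS ∅ (Finset.empty_subset _)
  have := h w hwS (Finset.notMem_empty _)
  linarith [hw f hf]

theorem GapShatters.notMem_of_ge {T : Type*} {η θ : ℝ} (hθ : 0 < θ) {B : Finset (T → ℝ)}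
    {S : Finset (T × ℤ)} (hS : GapShatters η θ B S) {w : T × ℤ}
    (hw : ∀ f ∈ B, f w.1 ≤ η * w.2 - θ) : w ∉ S := fun hwS => by
  obtain ⟨f, hf, h, -⟩ := hS S subset_rfl
  have := h w hwS
  linarith [hw f hf]

/-- If two subclasses are separated at a pair `w`, the numbers of sets they shatter add up. -/
theorem card_gapShattered_add_le {T : Type*} {η θ : ℝ} (hθ : 0 < θ) {B B₁ B₂ : Finset (T → ℝ)}
    (h₁ : B₁ ⊆ B) (h₂ : B₂ ⊆ B) {W : Finset (T × ℤ)} {w : T × ℤ} (hw : w ∈ W)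
    (hB₁ : ∀ f ∈ B₁, η * w.2 + θ ≤ f w.1) (hB₂ : ∀ f ∈ B₂, f w.1 ≤ η * w.2 - θ) :
    (gapShattered η θ B₁ W).card + (gapShattered η θ B₂ W).card ≤ (gapShattered η θ B W).card := by
  classical
  set S₁ := gapShattered η θ B₁ W
  set S₂ := gapShattered η θ B₂ W
  have hn₁ : ∀ S ∈ S₁, w ∉ S := fun S hS => (mem_gapShattered.1 hS).2.notMem_of_le hθ hB₁
  have hn₂ : ∀ S ∈ S₂, w ∉ S := fun S hS => (mem_gapShattered.1 hS).2.notMem_of_ge hθ hB₂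
  -- No set shattered by `B₁` or by `B₂` contains `w`. A set shattered by both stays shattered by
  -- `B` after adding `w`: take functions from `B₁` when `w` must be above its level and from `B₂`
  -- otherwise. Such sets are counted twice on the left, and adding `w` supplies the second copy.
  have hinj : ((S₁ ∩ S₂).image (insert w)).card = (S₁ ∩ S₂).card := by
    refine Finset.card_image_of_injOn fun S hS S' hS' h => ?_
    have hS := hn₁ S (Finset.mem_inter.1 hS).1
    have hS' := hn₁ S' (Finset.mem_inter.1 hS').1
    rw [← Finset.erase_insert hS, ← Finset.erase_insert hS', h]
  have hdisj : Disjoint (S₁ ∪ S₂) ((S₁ ∩ S₂).image (insert w)) := by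
    rw [Finset.disjoint_left]
    intro S hS hS'
    obtain ⟨S', -, rfl⟩ := Finset.mem_image.1 hS'
    rcases Finset.mem_union.1 hS with h | h
    · exact hn₁ _ h (Finset.mem_insert_self _ _)
    · exact hn₂ _ h (Finset.mem_insert_self _ _)
  rw [← Finset.card_union_add_card_inter, ← hinj, ← Finset.card_union_of_disjoint hdisj]
  refine Finset.card_le_card fun S hS => ?_
  rcases Finset.mem_union.1 hS with hS | hS
  · rcases Finset.mem_union.1 hS with h | h
    · exact mem_gapShattered.2 ⟨(mem_gapShattered.1 h).1, (mem_gapShattered.1 h).2.mono h₁⟩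
    · exact mem_gapShattered.2 ⟨(mem_gapShattered.1 h).1, (mem_gapShattered.1 h).2.mono h₂⟩
  · obtain ⟨S', hS', rfl⟩ := Finset.mem_image.1 hS
    obtain ⟨hS₁, hS₂⟩ := Finset.mem_inter.1 hS'
    refine mem_gapShattered.2 ⟨Finset.insert_subset hw (mem_gapShattered.1 hS₁).1, fun U hU => ?_⟩
    by_cases hwU : w ∈ U
    · obtain ⟨f, hf, hf1, hf2⟩ := (mem_gapShattered.1 hS₁).2 (U.erase w)
        (by rwa [← Finset.subset_insert_iff])
      refine ⟨f, h₁ hf, fun s hs => ?_, fun s hs hsU => ?_⟩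
      · by_cases h : s = w
        · exact h ▸ hB₁ f hf
        · exact hf1 s (Finset.mem_erase.2 ⟨h, hs⟩)
      · rcases Finset.mem_insert.1 hs with rfl | hs
        · exact absurd hwU hsU
        · exact hf2 s hs fun h => hsU (Finset.mem_of_mem_erase h)
    · obtain ⟨f, hf, hf1, hf2⟩ := (mem_gapShattered.1 hS₂).2 U
        ((Finset.subset_insert_iff_of_notMem hwU).1 hU)
      refine ⟨f, h₂ hf, hf1, fun s hs hsU => ?_⟩
      rcases Finset.mem_insert.1 hs with rfl | hs
      · exact hB₂ f hf
      · exact hf2 s hs hsU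

/-! ### A small deviation principle -/

/-- Layer-cake formula with steps of length `2θ`: the weights are the increments `(2θ(j+1))² -
(2θj)²`. -/
theorem sq_max_le_sum_indicator {θ : ℝ} (hθ : 0 < θ) (y : ℝ) (J : ℕ) (hy : y ≤ 2 * θ * J) :
    (max y 0) ^ 2 ≤
      ∑ j ∈ Finset.range J, 4 * θ ^ 2 * (2 * j + 1) * (if 2 * θ * j < y then 1 else 0) := by
  induction J with
  | zero =>
    have : y ≤ 0 := by simpa using hy
    simp [max_eq_right this]
  | succ J ih =>
    by_cases h : y ≤ 2 * θ * J
    · rw [Finset.sum_range_succ, if_neg (not_lt.2 h)]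
      simpa using ih h
    · push Not at h
      have hsum : ∑ j ∈ Finset.range (J + 1),
          4 * θ ^ 2 * (2 * (j : ℝ) + 1) * (if 2 * θ * j < y then 1 else 0) =
          4 * θ ^ 2 * ((J : ℝ) + 1) ^ 2 := by
        have h1 : ∀ j ∈ Finset.range (J + 1),
            4 * θ ^ 2 * (2 * (j : ℝ) + 1) * (if 2 * θ * j < y then 1 else 0) =
            4 * θ ^ 2 * (2 * (j : ℝ) + 1) := by
          intro j hj
          have hj : (j : ℝ) ≤ J := by
            exact_mod_cast Nat.lt_succ_iff.1 (Finset.mem_range.1 hj)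
          rw [if_pos (lt_of_le_of_lt (by gcongr) h), mul_one]
        rw [Finset.sum_congr rfl h1, ← Finset.mul_sum]
        congr 1
        clear h1 h hy ih
        induction J with
        | zero => simp
        | succ J ih => rw [Finset.sum_range_succ, ih]; push_cast; ring
      rw [hsum]
      have h0 : (0 : ℝ) ≤ 2 * θ * J := by positivity
      rw [max_eq_left (h0.trans h.le)]
      push_cast at hy
      nlinarith

theorem sum_odd_div_two_pow (J : ℕ) :
    ∑ j ∈ Finset.range J, (2 * (j : ℝ) + 1) / 2 ^ (j + 1) = 3 - (2 * J + 3) / 2 ^ J := by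
  induction J with
  | zero => norm_num
  | succ J ih =>
    rw [Finset.sum_range_succ, ih]
    push_cast
    field_simp
    ring

/-- Two parts of a set of cardinality `N`, of cardinalities `Q` and `R`, are such that
`√Q + √R ≥ √N`, and none of them is empty. -/
def IsBalancedSplit (N Q R : ℕ) : Prop :=
  0 < Q ∧ 0 < R ∧ ∀ s r : ℕ, Q ≤ s ^ 2 → R ≤ r ^ 2 → N ≤ (s + r) ^ 2

theorem IsBalancedSplit.symm {N Q R : ℕ} (h : IsBalancedSplit N Q R) : IsBalancedSplit N R Q :=
  ⟨h.2.1, h.1, fun s r hs hr => by rw [add_comm]; exact h.2.2 r s hr hs⟩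

/-- Since `P ≤ 2Q` and `P ≤ R`, one has `P² ≤ 2QR ≤ (2sr)²`. The cross term in `(s + r)²` therefore
pays for the `P` elements not counted in `R`. In the application `s` and `r` are numbers of
shattered sets, which is why square roots are tested on integers. -/
theorem isBalancedSplit_of_le {N P Q R : ℕ} (hQ : 0 < Q) (hPN : 2 * P ≤ N) (hR : R + P = N)
    (hQP : P ≤ 2 * Q) (hQP' : Q ≤ P) : IsBalancedSplit N Q R := by
  refine ⟨hQ, by lia, fun s r hs hr => ?_⟩
  have h1 : P ^ 2 ≤ (2 * (s * r)) ^ 2 := by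
    have h2 : P * P ≤ (2 * Q) * R := Nat.mul_le_mul hQP (by lia)
    have h3 : Q * R ≤ s ^ 2 * r ^ 2 := Nat.mul_le_mul hs hr
    nlinarith
  have h2 : P ≤ 2 * (s * r) := (Nat.pow_le_pow_iff_left two_ne_zero).1 h1
  nlinarith

open Classical in
-- If more than half of the elements above `m + 2θj` also lay above `m + 2θ(j+1)`, the midpoint of
-- these two levels would split `A`. So the tail halves at each step, starting from one half at the
-- median, and `∑ (2j+1) / 2^(j+1) ≤ 3` gives the constant `12 = 4 · 3`.
theorem sum_sq_max_le_of_not_split {α : Type*} (A : Finset α) (φ : α → ℝ) {θ : ℝ} (hθ : 0 < θ)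
    (m : ℝ) (hm : 2 * (A.filter fun x => m < φ x).card ≤ A.card)
    (h : ∀ a : ℝ, ¬ IsBalancedSplit A.card (A.filter fun x => a + θ ≤ φ x).card
      (A.filter fun x => φ x ≤ a - θ).card) :
    ∑ x ∈ A, (max (φ x - m) 0) ^ 2 ≤ 12 * θ ^ 2 * A.card := by
  set P : ℕ → ℕ := fun j => (A.filter fun x => 2 * θ * j < φ x - m).card with hP
  have hP0 : 2 * P 0 ≤ A.card := by simpa [hP] using hm
  have hstep : ∀ j, 2 * P j ≤ A.card → 2 * P (j + 1) ≤ P j := by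
    intro j hj
    by_contra! hlt
    set a := m + (2 * j + 1) * θ
    have hR : (A.filter fun x => φ x ≤ a - θ).card + P j = A.card := by
      have h1 : P j = (A.filter fun x => ¬ φ x ≤ a - θ).card := by
        refine congrArg Finset.card (Finset.filter_congr fun x _ => ?_)
        simp only [a, not_le]
        constructor <;> intro <;> linarith
      rw [h1, Finset.card_filter_add_card_filter_not (fun x => φ x ≤ a - θ)]
    have hQ : P (j + 1) ≤ (A.filter fun x => a + θ ≤ φ x).card := by
      refine Finset.card_le_card fun x hx => ?_
      simp only [Finset.mem_filter, a] at hx ⊢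
      push_cast at hx
      exact ⟨hx.1, by linarith [hx.2]⟩
    have hQ' : (A.filter fun x => a + θ ≤ φ x).card ≤ P j := by
      refine Finset.card_le_card fun x hx => ?_
      simp only [Finset.mem_filter, a] at hx ⊢
      exact ⟨hx.1, by linarith [hx.2]⟩
    exact h a (isBalancedSplit_of_le (P := P j) (by lia) hj hR (by lia) hQ')
  have hle : ∀ j, 2 ^ (j + 1) * P j ≤ A.card := by
    intro j
    induction j with
    | zero => simpa using hP0
    | succ j ih =>
      have h2 : 2 * P j ≤ A.card := by
        refine le_trans (Nat.mul_le_mul_right _ ?_) ih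
        calc 2 = 2 ^ 1 := by norm_num
          _ ≤ 2 ^ (j + 1) := Nat.pow_le_pow_right (by norm_num) (by lia)
      calc 2 ^ (j + 1 + 1) * P (j + 1) = 2 ^ (j + 1) * (2 * P (j + 1)) := by ring
        _ ≤ 2 ^ (j + 1) * P j := Nat.mul_le_mul_left _ (hstep j h2)
        _ ≤ A.card := ih
  obtain ⟨J, hJ⟩ : ∃ J : ℕ, ∀ x ∈ A, φ x - m ≤ 2 * θ * J := by
    obtain ⟨b, hb⟩ := (A.image fun x => φ x - m).bddAbove
    obtain ⟨J, hJ⟩ := exists_nat_ge (b / (2 * θ))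
    refine ⟨J, fun x hx => ?_⟩
    have h1 : φ x - m ≤ b := hb (Finset.mem_coe.2 (Finset.mem_image_of_mem _ hx))
    rw [div_le_iff₀ (by positivity)] at hJ
    linarith
  calc ∑ x ∈ A, (max (φ x - m) 0) ^ 2
      ≤ ∑ x ∈ A, ∑ j ∈ Finset.range J,
          4 * θ ^ 2 * (2 * j + 1) * (if 2 * θ * j < φ x - m then 1 else 0) :=
        Finset.sum_le_sum fun x hx => sq_max_le_sum_indicator hθ _ J (hJ x hx)
    _ = ∑ j ∈ Finset.range J, 4 * θ ^ 2 * (2 * j + 1) * P j := by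
        rw [Finset.sum_comm]
        refine Finset.sum_congr rfl fun j _ => ?_
        rw [← Finset.mul_sum, Finset.sum_boole]
    _ ≤ ∑ j ∈ Finset.range J, 4 * θ ^ 2 * A.card * ((2 * (j : ℝ) + 1) / 2 ^ (j + 1)) := by
        refine Finset.sum_le_sum fun j _ => ?_
        have h1 : (2 : ℝ) ^ (j + 1) * P j ≤ A.card := by exact_mod_cast hle j
        rw [← mul_div_assoc, le_div_iff₀ (by positivity)]
        calc 4 * θ ^ 2 * (2 * (j : ℝ) + 1) * P j * 2 ^ (j + 1)
            = 4 * θ ^ 2 * (2 * (j : ℝ) + 1) * (2 ^ (j + 1) * P j) := by ring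
          _ ≤ 4 * θ ^ 2 * (2 * (j : ℝ) + 1) * A.card := by gcongr
          _ = _ := by ring
    _ ≤ 12 * θ ^ 2 * A.card := by
        rw [← Finset.mul_sum, sum_odd_div_two_pow]
        have h1 : (0 : ℝ) ≤ (2 * J + 3) / 2 ^ J := by positivity
        have h2 : (0 : ℝ) ≤ 4 * θ ^ 2 * A.card := by positivity
        nlinarith

open Classical in
-- The median is the smallest value having at most half of the elements strictly above it. The
-- largest value below it then has more than half above, which bounds what lies below.
theorem exists_median {α : Type*} (A : Finset α) (hA : A.Nonempty) (φ : α → ℝ) :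
    ∃ m : ℝ, 2 * (A.filter fun x => m < φ x).card ≤ A.card ∧
      2 * (A.filter fun x => φ x < m).card ≤ A.card := by
  have hne : (A.filter fun z => 2 * (A.filter fun x => φ z < φ x).card ≤ A.card).Nonempty := by
    obtain ⟨z, hz, hmax⟩ := A.exists_max_image φ hA
    refine ⟨z, Finset.mem_filter.2 ⟨hz, ?_⟩⟩
    rw [Finset.filter_eq_empty_iff.2 fun x hx => not_lt.2 (hmax x hx)]
    simp
  obtain ⟨z, hz, hmin⟩ := Finset.exists_min_image _ φ hne
  refine ⟨φ z, (Finset.mem_filter.1 hz).2, ?_⟩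
  rcases (A.filter fun x => φ x < φ z).eq_empty_or_nonempty with h | h
  · simp [h]
  · obtain ⟨y, hy, hmax⟩ := Finset.exists_max_image _ φ h
    obtain ⟨hyA, hyz⟩ := Finset.mem_filter.1 hy
    have h1 : A.card < 2 * (A.filter fun x => φ y < φ x).card := by
      by_contra! hle
      exact absurd (hmin y (Finset.mem_filter.2 ⟨hyA, hle⟩)) (not_le.2 hyz)
    have h2 := Finset.card_filter_add_card_filter_not (s := A) (fun x => φ x < φ z)
    have h3 : (A.filter fun x => φ y < φ x).card ≤ (A.filter fun x => ¬ φ x < φ z).card := by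
      refine Finset.card_le_card fun x hx => ?_
      obtain ⟨hxA, hx⟩ := Finset.mem_filter.1 hx
      refine Finset.mem_filter.2 ⟨hxA, fun hxz => ?_⟩
      exact absurd (hmax x (Finset.mem_filter.2 ⟨hxA, hxz⟩)) (not_le.2 hx)
    lia

open Classical in
-- Without a split, both tails around a median have second moment at most `12 θ² |A|`. The double
-- sum is at most `2 |A|` times the second moment around any point, hence the `48`.
theorem exists_isBalancedSplit {α : Type*} (A : Finset α) (φ : α → ℝ) {θ : ℝ} (hθ : 0 < θ)
    (h : 48 * θ ^ 2 * (A.card : ℝ) ^ 2 < ∑ x ∈ A, ∑ y ∈ A, (φ x - φ y) ^ 2) :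
    ∃ a : ℝ, IsBalancedSplit A.card (A.filter fun x => a + θ ≤ φ x).card
      (A.filter fun x => φ x ≤ a - θ).card := by
  by_contra! hno
  have hA : A.Nonempty := by
    rw [Finset.nonempty_iff_ne_empty]
    rintro rfl
    simp at h
  obtain ⟨m, hm1, hm2⟩ := exists_median A hA φ
  have h1 := sum_sq_max_le_of_not_split A φ hθ m hm1 hno
  have h2 := sum_sq_max_le_of_not_split A (fun x => -φ x) hθ (-m) (by simpa using hm2) (by
    intro a ha
    refine hno (-a) ?_
    convert ha.symm using 2
    · congr 1; ext x; constructor <;> intro <;> linarith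
    · congr 1; ext x; constructor <;> intro <;> linarith)
  have h3 : ∑ x ∈ A, (φ x - m) ^ 2 ≤ 24 * θ ^ 2 * A.card := by
    calc ∑ x ∈ A, (φ x - m) ^ 2
        = ∑ x ∈ A, (max (φ x - m) 0) ^ 2 + ∑ x ∈ A, (max (-φ x - -m) 0) ^ 2 := by
          rw [← Finset.sum_add_distrib]
          refine Finset.sum_congr rfl fun x _ => ?_
          rcases le_total (φ x - m) 0 with h | h
          · rw [max_eq_right h, max_eq_left (by linarith)]; ring
          · rw [max_eq_left h, max_eq_right (by linarith)]; ring
      _ ≤ 24 * θ ^ 2 * A.card := by linarith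
  have h4 : ∑ x ∈ A, ∑ y ∈ A, (φ x - φ y) ^ 2 =
      2 * A.card * ∑ x ∈ A, (φ x - m) ^ 2 - 2 * (∑ x ∈ A, (φ x - m)) ^ 2 := by
    have h5 : ∀ x ∈ A, ∑ y ∈ A, (φ x - φ y) ^ 2 = A.card * (φ x - m) ^ 2 -
        2 * (φ x - m) * ∑ y ∈ A, (φ y - m) + ∑ y ∈ A, (φ y - m) ^ 2 := by
      intro x _
      rw [Finset.mul_sum, ← nsmul_eq_mul, ← Finset.sum_const, ← Finset.sum_sub_distrib,
        ← Finset.sum_add_distrib]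
      exact Finset.sum_congr rfl fun y _ => by ring
    rw [Finset.sum_congr rfl h5, Finset.sum_add_distrib, Finset.sum_sub_distrib, ← Finset.mul_sum,
      ← Finset.sum_mul, ← Finset.mul_sum, Finset.sum_const, nsmul_eq_mul]
    ring
  have h5 : (A.card : ℝ) * ∑ x ∈ A, (φ x - m) ^ 2 ≤ A.card * (24 * θ ^ 2 * A.card) := by gcongr
  nlinarith [sq_nonneg (∑ x ∈ A, (φ x - m))]

/-! ### Separated classes shatter many sets -/

open Classical in
/-- A class which is separated in the `L²` norm of `k` points shatters many sets of pairs. -/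
theorem card_le_sq_card_gapShattered {T : Type*} {k : ℕ} (x : Fin k → T) {M ε : ℝ} (hε : 0 < ε)
    (B : Finset (T → ℝ)) (hB : B.Nonempty) (hM : ∀ f ∈ B, ∀ t, f t ∈ Set.Icc (-M) M)
    (hsep : ∀ f ∈ B, ∀ g ∈ B, f ≠ g → k * ε ^ 2 / 4 ≤ ∑ j, (f (x j) - g (x j)) ^ 2)
    (hk : 0 < k) :
    B.card ≤ (gapShattered (ε / 16) (ε / 96) B
      (Finset.univ.image x ×ˢ Finset.Icc ⌈-M / (ε / 16)⌉ ⌊M / (ε / 16)⌋)).card ^ 2 := by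
  set W := Finset.univ.image x ×ˢ Finset.Icc ⌈-M / (ε / 16)⌉ ⌊M / (ε / 16)⌋ with hW
  induction B using Finset.strongInduction with
  | H B ih =>
  rcases Nat.lt_or_ge B.card 2 with h1 | h2
  · have h0 : ∅ ∈ gapShattered (ε / 16) (ε / 96) B W := by
      obtain ⟨f, hf⟩ := hB
      refine mem_gapShattered.2 ⟨Finset.empty_subset _, fun U hU => ⟨f, hf, ?_, by simp⟩⟩
      rw [Finset.subset_empty.1 hU]
      simp
    have := Finset.card_pos.2 ⟨_, h0⟩
    nlinarith
  · have hN : (2 : ℝ) ≤ B.card := by exact_mod_cast h2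
    have hsum : k * ((B.card : ℝ) ^ 2 * ε ^ 2 / 8) ≤
        ∑ j, ∑ f ∈ B, ∑ g ∈ B, (f (x j) - g (x j)) ^ 2 := by
      rw [Finset.sum_comm]
      have h3 : ∀ f ∈ B, (B.card - 1) * (k * ε ^ 2 / 4) ≤
          ∑ j, ∑ g ∈ B, (f (x j) - g (x j)) ^ 2 := by
        intro f hf
        rw [Finset.sum_comm, ← Finset.add_sum_erase B _ hf]
        have h4 : ∑ g ∈ B.erase f, k * ε ^ 2 / 4 ≤
            ∑ g ∈ B.erase f, ∑ j, (f (x j) - g (x j)) ^ 2 :=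
          Finset.sum_le_sum fun g hg =>
            hsep f hf g (Finset.mem_of_mem_erase hg) (Finset.ne_of_mem_erase hg).symm
        rw [Finset.sum_const, Finset.card_erase_of_mem hf, nsmul_eq_mul,
          Nat.cast_sub (by lia), Nat.cast_one] at h4
        simpa using h4
      refine le_trans ?_ (Finset.sum_le_sum h3)
      rw [Finset.sum_const, nsmul_eq_mul]
      have h5 : (0 : ℝ) ≤ k * ε ^ 2 / 8 := by positivity
      nlinarith [mul_nonneg h5 (mul_nonneg (by linarith : (0 : ℝ) ≤ B.card)
        (by linarith : (0 : ℝ) ≤ B.card - 2))]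
    -- Pigeonhole over the coordinates; the `8` comes from `N (N - 1) ≥ N² / 2` for `N ≥ 2`.
    obtain ⟨j, hj⟩ : ∃ j, (B.card : ℝ) ^ 2 * ε ^ 2 / 8 ≤
        ∑ f ∈ B, ∑ g ∈ B, (f (x j) - g (x j)) ^ 2 := by
      by_contra! hlt
      have : Nonempty (Fin k) := ⟨⟨0, hk⟩⟩
      have := Finset.sum_lt_sum_of_nonempty Finset.univ_nonempty fun j _ => hlt j
      rw [Finset.sum_const, Finset.card_univ, Fintype.card_fin, nsmul_eq_mul] at this
      linarith
    -- With half-gap `ε / 24` the required variance is `48 / 24² = 1 / 12`, below the available `1 /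
    -- 8`. Rounding the level to the grid of mesh `ε / 16` costs at most `ε / 32`, leaving `ε / 24 -
    -- ε / 32 = ε / 96`.
    obtain ⟨a, hQ, hR, hQR⟩ := exists_isBalancedSplit B (fun f => f (x j))
      (by positivity : 0 < ε / 24) (lt_of_lt_of_le (by
        have : 0 < (B.card : ℝ) ^ 2 * ε ^ 2 := by positivity
        nlinarith) hj)
    set B₁ := B.filter fun f => a + ε / 24 ≤ f (x j)
    set B₂ := B.filter fun f => f (x j) ≤ a - ε / 24
    set b : ℤ := round (a / (ε / 16))
    have hb : |ε / 16 * b - a| ≤ ε / 32 := by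
      have h3 := abs_sub_round (a / (ε / 16))
      have h4 : ε / 16 * b - a = -(ε / 16 * (a / (ε / 16) - b)) := by
        field_simp
        ring
      rw [h4, abs_neg, abs_mul, abs_of_pos (by positivity : 0 < ε / 16)]
      calc ε / 16 * |a / (ε / 16) - b| ≤ ε / 16 * (1 / 2) := by gcongr
        _ = ε / 32 := by ring
    obtain ⟨hb1, hb2⟩ := abs_le.1 hb
    have hB₁ : ∀ f ∈ B₁, ε / 16 * b + ε / 96 ≤ f (x j) := fun f hf => by
      linarith [(Finset.mem_filter.1 hf).2]
    have hB₂ : ∀ f ∈ B₂, f (x j) ≤ ε / 16 * b - ε / 96 := fun f hf => by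
      linarith [(Finset.mem_filter.1 hf).2]
    obtain ⟨f₁, hf₁⟩ := Finset.card_pos.1 hQ
    obtain ⟨f₂, hf₂⟩ := Finset.card_pos.1 hR
    have hs₁ : B₁ ⊆ B := Finset.filter_subset _ _
    have hs₂ : B₂ ⊆ B := Finset.filter_subset _ _
    have hss₁ : B₁ ⊂ B := by
      refine Finset.ssubset_iff_subset_ne.2 ⟨hs₁, fun he => ?_⟩
      have h3 := hB₁ f₂ (he ▸ hs₂ hf₂)
      linarith [hB₂ f₂ hf₂]
    have hss₂ : B₂ ⊂ B := by
      refine Finset.ssubset_iff_subset_ne.2 ⟨hs₂, fun he => ?_⟩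
      have h3 := hB₂ f₁ (he ▸ hs₁ hf₁)
      linarith [hB₁ f₁ hf₁]
    have hw : (x j, b) ∈ W := by
      refine Finset.mem_product.2 ⟨Finset.mem_image_of_mem _ (Finset.mem_univ _), ?_⟩
      rw [Finset.mem_Icc, Int.ceil_le, Int.le_floor, div_le_iff₀ (by positivity),
        le_div_iff₀ (by positivity)]
      constructor
      · linarith [hB₂ f₂ hf₂, (hM f₂ (hs₂ hf₂) (x j)).1]
      · linarith [hB₁ f₁ hf₁, (hM f₁ (hs₁ hf₁) (x j)).2]
    have ih₁ := ih B₁ hss₁ ⟨f₁, hf₁⟩ (fun f hf => hM f (hs₁ hf))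
      (fun f hf g hg => hsep f (hs₁ hf) g (hs₁ hg))
    have ih₂ := ih B₂ hss₂ ⟨f₂, hf₂⟩ (fun f hf => hM f (hs₂ hf))
      (fun f hf g hg => hsep f (hs₂ hf) g (hs₂ hg))
    exact (hQR _ _ ih₁ ih₂).trans (Nat.pow_le_pow_left
      (card_gapShattered_add_le (by positivity) hs₁ hs₂ hw hB₁ hB₂) 2)

/-- The number of subsets of cardinality at most `V` of a finite set. -/
theorem card_filter_card_le {α : Type*} (W : Finset α) (A : Finset (Finset α)) {V Q : ℝ}
    (hV : 0 < V) (hVQ : V ≤ Q) (hW : (W.card : ℝ) ≤ Q) (hA : A ⊆ W.powerset)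
    (hAV : ∀ S ∈ A, (S.card : ℝ) ≤ V) :
    (A.card : ℝ) ≤ Real.exp (V * (1 + Real.log (Q / V))) := by
  have hQ : 0 < Q := hV.trans_le hVQ
  have h1 : 1 ≤ Q / V := (one_le_div hV).2 hVQ
  -- Exponential weights: the factor is at least 1 on sets of size at most `V`, and the sum over all
  -- subsets factorizes by the binomial theorem.
  have hterm : ∀ S ∈ A, (1 : ℝ) ≤ (Q / V) ^ V * ((V / Q) ^ S.card * 1 ^ (W.card - S.card)) := by
    intro S hS
    rw [one_pow, mul_one, ← inv_div Q V, inv_pow, ← div_eq_mul_inv, one_le_div (by positivity),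
      ← Real.rpow_natCast]
    exact Real.rpow_le_rpow_of_exponent_le h1 (hAV S hS)
  calc (A.card : ℝ) = ∑ S ∈ A, (1 : ℝ) := by simp
    _ ≤ ∑ S ∈ A, (Q / V) ^ V * ((V / Q) ^ S.card * 1 ^ (W.card - S.card)) :=
        Finset.sum_le_sum hterm
    _ ≤ ∑ S ∈ W.powerset, (Q / V) ^ V * ((V / Q) ^ S.card * 1 ^ (W.card - S.card)) :=
        Finset.sum_le_sum_of_subset_of_nonneg hA fun _ _ _ => by positivity
    _ = (Q / V) ^ V * (V / Q + 1) ^ W.card := by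
        rw [← Finset.mul_sum, Finset.sum_pow_mul_eq_add_pow]
    _ ≤ (Q / V) ^ V * Real.exp V := by
        gcongr
        calc (V / Q + 1) ^ W.card ≤ Real.exp (V / Q) ^ W.card := by
              gcongr
              exact Real.add_one_le_exp _
          _ = Real.exp (W.card * (V / Q)) := (Real.exp_nat_mul _ _).symm
          _ ≤ Real.exp V := by
              rw [Real.exp_le_exp]
              calc (W.card : ℝ) * (V / Q) ≤ Q * (V / Q) := by gcongr
                _ = V := by field_simp
    _ = Real.exp (V * (1 + Real.log (Q / V))) := by
        rw [Real.rpow_def_of_pos (by positivity), ← Real.exp_add]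
        congr 1
        ring

open Classical in
-- Two distinct pairs over the same point cannot both belong to `S`: isolating each in turn would
-- put each level strictly below the other. So projecting to points loses nothing, and each point
-- keeps its level as witness.
theorem GapShatters.isFatShattered {T : Type*} {η θ M : ℝ} (hθ : 0 < θ) {B : Finset (T → ℝ)}
    {F : Set (T → ℝ)} (hBF : ∀ f ∈ B, f ∈ F) (hM : ∀ f ∈ B, ∀ t, f t ∈ Set.Icc (-M) M)
    {S : Finset (T × ℤ)} (hS : GapShatters η θ B S) :
    IsFatShattered (Set.Icc (-M) M) F θ (S.image Prod.fst) ∧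
      (S.image Prod.fst).card = S.card := by
  have hinj : Set.InjOn Prod.fst (S : Set (T × ℤ)) := by
    have key : ∀ s ∈ S, ∀ s' ∈ S, s.1 = s'.1 → s ≠ s' → η * s.2 + θ ≤ η * s'.2 - θ := by
      intro s hs s' hs' h hne
      obtain ⟨f, -, h1, h2⟩ := hS {s} (by simpa using hs)
      have h1 := h1 s (by simp)
      have h2 := h2 s' hs' (by simpa using hne.symm)
      rw [h] at h1
      exact h1.trans h2
    intro s hs s' hs' h
    by_contra hne
    have h1 := key s hs s' hs' h hne
    have h2 := key s' hs' s hs h.symm (Ne.symm hne)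
    linarith
  refine ⟨?_, Finset.card_image_of_injOn hinj⟩
  choose! c hc using fun t (ht : t ∈ S.image Prod.fst) => Finset.mem_image.1 ht
  have hcs : ∀ s ∈ S, c s.1 = s := fun s hs =>
    hinj (hc s.1 (Finset.mem_image_of_mem _ hs)).1 hs (hc s.1 (Finset.mem_image_of_mem _ hs)).2
  refine ⟨fun t => η * (c t).2, fun t ht => ?_, fun l => ?_⟩
  · obtain ⟨s, hs, rfl⟩ := Finset.mem_image.1 ht
    simp only [hcs s hs]
    obtain ⟨f, hf, h1, -⟩ := hS S subset_rfl
    obtain ⟨g, hg, -, h2⟩ := hS ∅ (Finset.empty_subset _)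
    have h1 := h1 s hs
    have h2 := h2 s hs (by simp)
    exact ⟨by linarith [(hM g hg s.1).1], by linarith [(hM f hf s.1).2]⟩
  · obtain ⟨f, hf, h1, h2⟩ := hS (S.filter fun s => l s.1 = 1) (Finset.filter_subset _ _)
    refine ⟨f, hBF f hf, fun t ht => ?_⟩
    obtain ⟨s, hs, rfl⟩ := Finset.mem_image.1 ht
    simp only [hcs s hs]
    rcases Int.units_eq_one_or (l s.1) with h | h
    · have := h1 s (Finset.mem_filter.2 ⟨hs, h⟩)
      rw [h]
      push_cast
      linarith
    · have := h2 s hs (by simp [h])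
      rw [h]
      push_cast
      linarith

/-! ### Extraction of coordinates -/

theorem exp_neg_le_one_sub_half {u : ℝ} (h0 : 0 ≤ u) (h1 : u ≤ 1) : Real.exp (-u) ≤ 1 - u / 2 := by
  rw [Real.exp_neg, inv_le_comm₀ (Real.exp_pos _) (by linarith)]
  refine le_trans ?_ (Real.add_one_le_exp u)
  rw [inv_le_iff_one_le_mul₀ (by linarith)]
  nlinarith

/-- Drawing `k` coordinates at random keeps the separation of a small finite class. -/
theorem exists_separating_coordinates {T : Type*} {n k : ℕ} (hn : 0 < n) (z : Fin n → T)
    {M ε : ℝ} (hM0 : 0 < M) (A : Finset (T → ℝ)) (hM : ∀ f ∈ A, ∀ t, f t ∈ Set.Icc (-M) M)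
    (hsep : ∀ f ∈ A, ∀ g ∈ A, f ≠ g → n * ε ^ 2 ≤ ∑ i, (f (z i) - g (z i)) ^ 2)
    (hk : (A.card : ℝ) ^ 2 * Real.exp (-(k * ε ^ 2 / (16 * M ^ 2))) < 1) :
    ∃ c : Fin k → Fin n, ∀ f ∈ A, ∀ g ∈ A, f ≠ g →
      k * ε ^ 2 / 4 ≤ ∑ j, (f (z (c j)) - g (z (c j))) ^ 2 := by
  classical
  by_contra! hno
  have hn' : (0 : ℝ) < n := by exact_mod_cast hn
  -- Chernoff parameter: squared differences are at most `4M²`, so `l` times them lies in `[0, 1]`,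
  -- where `exp (-u) ≤ 1 - u / 2`.
  set l : ℝ := 1 / (4 * M ^ 2) with hl
  have hl0 : 0 < l := by positivity
  set D := (A ×ˢ A).filter fun p => p.1 ≠ p.2 with hD
  have hpair : ∀ p ∈ D, ∑ c : Fin k → Fin n,
      Real.exp (l * (k * ε ^ 2 / 4 - ∑ j, (p.1 (z (c j)) - p.2 (z (c j))) ^ 2)) ≤
      n ^ k * Real.exp (-(k * ε ^ 2 / (16 * M ^ 2))) := by
    rintro ⟨f, g⟩ hp
    obtain ⟨hfg, hne⟩ := Finset.mem_filter.1 hp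
    obtain ⟨hf, hg⟩ := Finset.mem_product.1 hfg
    have h1 : ∑ i, Real.exp (-(l * (f (z i) - g (z i)) ^ 2)) ≤
        n * Real.exp (-(l * ε ^ 2 / 2)) := by
      calc ∑ i, Real.exp (-(l * (f (z i) - g (z i)) ^ 2))
          ≤ ∑ i, (1 - l / 2 * (f (z i) - g (z i)) ^ 2) := by
            refine Finset.sum_le_sum fun i _ => ?_
            have hfi := hM f hf (z i)
            have hgi := hM g hg (z i)
            have h2 : (f (z i) - g (z i)) ^ 2 ≤ 4 * M ^ 2 := by
              have : |f (z i) - g (z i)| ≤ 2 * M :=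
                abs_le.2 ⟨by linarith [hfi.1, hgi.2], by linarith [hfi.2, hgi.1]⟩
              calc (f (z i) - g (z i)) ^ 2 = |f (z i) - g (z i)| ^ 2 := (sq_abs _).symm
                _ ≤ (2 * M) ^ 2 := by gcongr
                _ = 4 * M ^ 2 := by ring
            have h3 : l * (f (z i) - g (z i)) ^ 2 ≤ 1 := by
              rw [hl, one_div, inv_mul_le_iff₀ (by positivity)]
              linarith
            have := exp_neg_le_one_sub_half (by positivity) h3
            linarith
        _ = n - l / 2 * ∑ i, (f (z i) - g (z i)) ^ 2 := by
            rw [Finset.sum_sub_distrib, ← Finset.mul_sum]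
            simp
        _ ≤ n - l / 2 * (n * ε ^ 2) := by
            have := hsep f hf g hg hne
            gcongr
        _ = n * (-(l * ε ^ 2 / 2) + 1) := by ring
        _ ≤ n * Real.exp (-(l * ε ^ 2 / 2)) := by
            gcongr
            exact Real.add_one_le_exp _
    calc ∑ c : Fin k → Fin n,
          Real.exp (l * (k * ε ^ 2 / 4 - ∑ j, (f (z (c j)) - g (z (c j))) ^ 2))
        = Real.exp (l * (k * ε ^ 2 / 4)) *
            (∑ i, Real.exp (-(l * (f (z i) - g (z i)) ^ 2))) ^ k := by
          rw [Fintype.sum_pow, Finset.mul_sum]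
          refine Finset.sum_congr rfl fun c _ => ?_
          rw [← Real.exp_sum, ← Real.exp_add, Finset.sum_neg_distrib, ← Finset.mul_sum]
          congr 1
          ring
      _ ≤ Real.exp (l * (k * ε ^ 2 / 4)) * (n * Real.exp (-(l * ε ^ 2 / 2))) ^ k := by
          gcongr
      _ = n ^ k * Real.exp (-(k * ε ^ 2 / (16 * M ^ 2))) := by
          rw [mul_pow, ← Real.exp_nat_mul, mul_left_comm, ← Real.exp_add]
          congr 2
          rw [hl]
          field_simp
          ring
  -- Union bound over pairs, as counting: if every choice of coordinates failed for some pair, each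
  -- would contribute at least 1 to the double sum.
  have hlow : (n : ℝ) ^ k ≤ ∑ p ∈ D, ∑ c : Fin k → Fin n,
      Real.exp (l * (k * ε ^ 2 / 4 - ∑ j, (p.1 (z (c j)) - p.2 (z (c j))) ^ 2)) := by
    rw [Finset.sum_comm]
    calc (n : ℝ) ^ k = ∑ c : Fin k → Fin n, (1 : ℝ) := by simp
      _ ≤ _ := by
        refine Finset.sum_le_sum fun c _ => ?_
        obtain ⟨f, hf, g, hg, hne, hlt⟩ := hno c
        have hp : (f, g) ∈ D := Finset.mem_filter.2 ⟨Finset.mem_product.2 ⟨hf, hg⟩, hne⟩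
        refine le_trans ?_ (Finset.single_le_sum (fun _ _ => (Real.exp_pos _).le) hp)
        exact Real.one_le_exp (mul_nonneg hl0.le (by linarith))
  have hup := Finset.sum_le_sum hpair
  rw [Finset.sum_const, nsmul_eq_mul] at hup
  have hDc : (D.card : ℝ) ≤ (A.card : ℝ) ^ 2 := by
    have := Finset.card_filter_le (A ×ˢ A) fun p => p.1 ≠ p.2
    rw [Finset.card_product] at this
    rw [sq]
    exact_mod_cast this
  have hnk : (0 : ℝ) < n ^ k := by positivity
  have h4 : (D.card : ℝ) * (n ^ k * Real.exp (-(k * ε ^ 2 / (16 * M ^ 2)))) ≤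
      (A.card : ℝ) ^ 2 * (n ^ k * Real.exp (-(k * ε ^ 2 / (16 * M ^ 2)))) := by gcongr
  nlinarith

/-! ### Dimension-free bound on the `L²` entropy -/

/-- The small slope lets a logarithm of the unknown entropy be absorbed into a linear term. -/
theorem log_le_div_eight {u : ℝ} (hu : 0 < u) : Real.log u ≤ u / 8 + 2 := by
  have h1 := Real.log_le_sub_one_of_pos (by positivity : 0 < u / 8)
  have h2 : Real.log 8 ≤ 3 := by
    rw [show (8 : ℝ) = 2 ^ 3 by norm_num, Real.log_pow]
    have := Real.log_two_lt_d9
    norm_num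
    linarith
  rw [Real.log_div hu.ne' (by norm_num)] at h1
  linarith

theorem two_le_log_fourteen_mul {y : ℝ} (hy : 1 ≤ y) : 2 ≤ Real.log (14 * y) := by
  rw [Real.le_log_iff_exp_le (by linarith)]
  have h1 := Real.exp_one_lt_d9
  calc Real.exp 2 = Real.exp 1 ^ 2 := by rw [← Real.exp_nat_mul]; norm_num
    _ ≤ 3 ^ 2 := by gcongr; linarith
    _ ≤ 14 * y := by linarith

/-- A finite class which is `ε`-separated in the empirical `L²` norm has a cardinality controlled by
the fat-shattering dimension at scale `ε / 96`, whatever the size of the sample. -/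
theorem log_card_le_of_separated {T : Type*} {n : ℕ} (hn : 0 < n) (z : Fin n → T) {M ε V : ℝ}
    (hε : 0 < ε) (hεM : ε ≤ M) (hV : 0 < V) {F : Set (T → ℝ)}
    (hM : ∀ f ∈ F, ∀ t, f t ∈ Set.Icc (-M) M)
    (hdim : ∀ s : Finset T, s.Nonempty → IsFatShattered (Set.Icc (-M) M) F (ε / 96) s →
      (s.card : ℝ) ≤ V)
    (A : Finset (T → ℝ)) (hAF : ∀ f ∈ A, f ∈ F)
    (hsep : ∀ f ∈ A, ∀ g ∈ A, f ≠ g → n * ε ^ 2 ≤ ∑ i, (f (z i) - g (z i)) ^ 2) :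
    Real.log A.card ≤ 20 * V * Real.log (14 * M / ε) := by
  classical
  have hM0 : 0 < M := hε.trans_le hεM
  set y := M / ε with hy
  have hy1 : 1 ≤ y := (one_le_div hε).2 hεM
  have hL := two_le_log_fourteen_mul hy1
  rw [mul_div_assoc, ← hy]
  have hMA : ∀ f ∈ A, ∀ t, f t ∈ Set.Icc (-M) M := fun f hf => hM f (hAF f hf)
  rcases Nat.lt_or_ge A.card 2 with h2 | h2
  · have h3 : Real.log A.card = 0 := by
      have : A.card = 0 ∨ A.card = 1 := by lia
      rcases this with h | h <;> simp [h]
    rw [h3]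
    positivity
  by_contra! hlt
  set x := Real.log A.card with hx
  have hx0 : 1 / 2 < x := by
    have h3 : Real.log 2 ≤ x := Real.log_le_log (by norm_num) (by exact_mod_cast h2)
    have := Real.log_two_gt_d9
    linarith
  have hcard : (A.card : ℝ) = Real.exp x := by
    rw [hx, Real.exp_log (by exact_mod_cast (by lia : 0 < A.card))]
  -- The union bound needs `2x < k / (16 y²)`, that is `k > 32 y² x`.
  set k := ⌊32 * y ^ 2 * x⌋₊ + 1 with hk
  have hk1 : 32 * y ^ 2 * x < k := by
    rw [hk]
    push_cast
    exact Nat.lt_floor_add_one _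
  have hk2 : (k : ℝ) ≤ 64 * y ^ 2 * x := by
    rw [hk]
    push_cast
    have h3 := Nat.floor_le (by positivity : 0 ≤ 32 * y ^ 2 * x)
    have h4 : 1 ≤ y ^ 2 := one_le_pow₀ hy1
    nlinarith
  obtain ⟨c, hc⟩ := exists_separating_coordinates (k := k) hn z hM0 A hMA hsep (by
    rw [hcard, ← Real.exp_nat_mul, ← Real.exp_add, Real.exp_lt_one_iff]
    have h3 : (k : ℝ) * ε ^ 2 / (16 * M ^ 2) = k / (16 * y ^ 2) := by
      rw [hy]
      field_simp
    have h4 : 2 * x < k / (16 * y ^ 2) := by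
      rw [lt_div_iff₀ (by positivity)]
      linarith
    rw [h3]
    push_cast
    linarith)
  have hsq := card_le_sq_card_gapShattered (z ∘ c) hε A (Finset.card_pos.1 (by lia)) hMA hc
    (by lia)
  set W := Finset.univ.image (z ∘ c) ×ˢ Finset.Icc ⌈-M / (ε / 16)⌉ ⌊M / (ε / 16)⌋ with hW
  have hWc : (W.card : ℝ) ≤ 2112 * y ^ 3 * x := by
    rw [hW, Finset.card_product, Nat.cast_mul]
    have h3 : ((Finset.univ.image (z ∘ c)).card : ℝ) ≤ k := by
      have := Finset.card_image_le (s := Finset.univ) (f := z ∘ c)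
      rw [Finset.card_univ, Fintype.card_fin] at this
      exact_mod_cast this
    have h4 : ((Finset.Icc ⌈-M / (ε / 16)⌉ ⌊M / (ε / 16)⌋).card : ℝ) ≤ 33 * y := by
      have h5 : M / (ε / 16) = 16 * y := by
        rw [hy]
        field_simp
      rw [neg_div, h5, Int.card_Icc]
      have h6 : ⌈-(16 * y)⌉ ≤ ⌊16 * y⌋ + 1 := by
        rw [Int.ceil_neg]
        have : 0 ≤ ⌊16 * y⌋ := Int.floor_nonneg.2 (by linarith)
        lia
      have h7 : (((⌊16 * y⌋ + 1 - ⌈-(16 * y)⌉).toNat : ℤ) : ℝ) ≤ 33 * y := by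
        rw [Int.toNat_of_nonneg (by lia), Int.ceil_neg]
        push_cast
        linarith [Int.floor_le (16 * y)]
      exact_mod_cast h7
    calc _ ≤ k * (33 * y) := mul_le_mul h3 h4 (Nat.cast_nonneg _) (Nat.cast_nonneg _)
      _ ≤ 64 * y ^ 2 * x * (33 * y) := by gcongr
      _ = _ := by ring
  set Q := 2112 * y ^ 3 * x with hQ
  have hVx : V ≤ x := by nlinarith
  have hVQ : V ≤ Q := by
    have h3 : 1 ≤ y ^ 3 := one_le_pow₀ hy1
    have h4 : 0 < x := by linarith
    have h5 : (1 : ℝ) * x ≤ y ^ 3 * x := by gcongr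
    linarith
  have hcount := card_filter_card_le W (gapShattered (ε / 16) (ε / 96) A W) hV hVQ hWc
    (fun S hS => Finset.mem_powerset.2 (mem_gapShattered.1 hS).1) (by
      intro S hS
      obtain ⟨h3, h4⟩ := (mem_gapShattered.1 hS).2.isFatShattered (by positivity) hAF hMA
      rw [← h4]
      rcases (S.image Prod.fst).eq_empty_or_nonempty with h | h
      · simp [h, hV.le]
      · exact hdim _ h h3)
  have hx2 : x ≤ 2 * (V * (1 + Real.log (Q / V))) := by
    rw [← Real.exp_le_exp, ← hcard]
    calc (A.card : ℝ) ≤ ((gapShattered (ε / 16) (ε / 96) A W).card : ℝ) ^ 2 := by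
          exact_mod_cast hsq
      _ ≤ Real.exp (V * (1 + Real.log (Q / V))) ^ 2 :=
        pow_le_pow_left₀ (Nat.cast_nonneg _) hcount 2
      _ = _ := by rw [← Real.exp_nat_mul]; norm_num
  set u := x / V with hu
  have hxu : x = V * u := by
    rw [hu]
    field_simp
  have hu0 : 0 < u := by positivity
  have hlogQ : Real.log (Q / V) = Real.log 2112 + 3 * Real.log y + Real.log u := by
    have h3 : Q / V = 2112 * y ^ 3 * u := by
      rw [hQ, hu]
      ring
    rw [h3, Real.log_mul (by positivity) hu0.ne', Real.log_mul (by norm_num) (by positivity),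
      Real.log_pow]
    norm_num
  have h2112 : Real.log 2112 ≤ 9 := by
    calc Real.log 2112 ≤ Real.log (2 ^ 12) := Real.log_le_log (by norm_num) (by norm_num)
      _ = 12 * Real.log 2 := by rw [Real.log_pow]; norm_num
      _ ≤ 9 := by linarith [Real.log_two_lt_d9]
  -- Self-bounding inequality for `u = x / V`: the right side is at most `24 + 6 log y + u / 4`,
  -- contradicting `u > 20 (log 14 + log y)` because `log 14 ≥ 2`.
  have hu1 : u ≤ 2 * (1 + Real.log (Q / V)) := by
    rw [hxu] at hx2
    nlinarith
  have hu2 : 20 * Real.log (14 * y) < u := by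
    rw [hxu] at hlt
    nlinarith
  have hu3 := log_le_div_eight hu0
  have hly : 0 ≤ Real.log y := Real.log_nonneg hy1
  have hl14 := two_le_log_fourteen_mul le_rfl
  rw [mul_one] at hl14
  rw [Real.log_mul (by norm_num) (by positivity)] at hu2
  linarith

/-- Existence of proper `ε`-nets in the empirical `L²` norm. -/
theorem exists_net {T : Type*} {n : ℕ} (hn : 0 < n) (z : Fin n → T) {M ε V : ℝ}
    (hε : 0 < ε) (hεM : ε ≤ M) (hV : 0 < V) {F : Set (T → ℝ)}
    (hM : ∀ f ∈ F, ∀ t, f t ∈ Set.Icc (-M) M)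
    (hdim : ∀ s : Finset T, s.Nonempty → IsFatShattered (Set.Icc (-M) M) F (ε / 96) s →
      (s.card : ℝ) ≤ V) :
    ∃ A : Finset (T → ℝ), (∀ f ∈ A, f ∈ F) ∧
      Real.log A.card ≤ 20 * V * Real.log (14 * M / ε) ∧
      ∀ f ∈ F, ∃ g ∈ A, ∑ i, (f (z i) - g (z i)) ^ 2 ≤ n * ε ^ 2 := by
  classical
  set s : Set ℕ := {N | ∃ A : Finset (T → ℝ), A.card = N ∧ (∀ f ∈ A, f ∈ F) ∧
    ∀ f ∈ A, ∀ g ∈ A, f ≠ g → n * ε ^ 2 ≤ ∑ i, (f (z i) - g (z i)) ^ 2} with hs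
  have hbdd : BddAbove s := by
    refine ⟨⌊Real.exp (20 * V * Real.log (14 * M / ε))⌋₊, ?_⟩
    rintro N ⟨A, rfl, hAF, hsep⟩
    rcases Nat.eq_zero_or_pos A.card with h | h
    · rw [h]
      exact Nat.zero_le _
    · exact Nat.le_floor ((Real.log_le_iff_le_exp (by exact_mod_cast h)).1
        (log_card_le_of_separated hn z hε hεM hV hM hdim A hAF hsep))
  -- A separated set of maximal cardinality: a function far from all its elements could be added to
  -- it.
  obtain ⟨A, hA, hAF, hsep⟩ := Nat.sSup_mem (s := s) ⟨0, ∅, by simp⟩ hbdd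
  refine ⟨A, hAF, log_card_le_of_separated hn z hε hεM hV hM hdim A hAF hsep, fun f hf => ?_⟩
  by_contra! hno
  have hfA : f ∉ A := fun h => by
    have := hno f h
    simp only [sub_self, ne_eq, OfNat.ofNat_ne_zero, not_false_eq_true, zero_pow,
      Finset.sum_const_zero] at this
    exact absurd this (not_lt.2 (by positivity))
  have hmem : (insert f A).card ∈ s := by
    refine ⟨insert f A, rfl, fun g hg => ?_, fun g hg h hh hne => ?_⟩
    · rcases Finset.mem_insert.1 hg with rfl | hg
      exacts [hf, hAF g hg]
    · rcases Finset.mem_insert.1 hg with rfl | hgA <;> rcases Finset.mem_insert.1 hh with rfl | hhA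
      · exact absurd rfl hne
      · exact (hno h hhA).le
      · refine (hno g hgA).le.trans (le_of_eq (Finset.sum_congr rfl fun i _ => by ring))
      · exact hsep g hgA h hhA hne
  have := le_csSup hbdd hmem
  rw [← hA, Finset.card_insert_of_notMem hfA] at this
  lia

/-! ### Averages over signs -/

/-- The average over the signs `σ` of `∑ i, σ i * s σ i`, where the vector `s σ` may depend on the
signs. -/
noncomputable def signAverage {n : ℕ} (s : (Fin n → ℤˣ) → EuclideanSpace ℝ (Fin n)) : ℝ :=
  (1 / (2 : ℝ) ^ n) * ∑ σ : Fin n → ℤˣ, ∑ i, (((σ i : ℤˣ) : ℤ) : ℝ) * s σ i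

theorem signAverage_add {n : ℕ} (s t : (Fin n → ℤˣ) → EuclideanSpace ℝ (Fin n)) :
    signAverage (fun σ => s σ + t σ) = signAverage s + signAverage t := by
  simp only [signAverage, PiLp.add_apply, mul_add, Finset.sum_add_distrib]

theorem card_signs (n : ℕ) : ((Finset.univ : Finset (Fin n → ℤˣ)).card : ℝ) = 2 ^ n := by
  rw [Finset.card_univ, Fintype.card_fun, Fintype.card_units_int, Fintype.card_fin]
  norm_num

theorem signAverage_le {n : ℕ} (s : (Fin n → ℤˣ) → EuclideanSpace ℝ (Fin n)) {B : ℝ}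
    (h : ∀ σ : Fin n → ℤˣ, ∑ i, (((σ i : ℤˣ) : ℤ) : ℝ) * s σ i ≤ B) : signAverage s ≤ B := by
  have h1 := Finset.sum_le_sum fun σ (_ : σ ∈ Finset.univ) => h σ
  rw [Finset.sum_const, nsmul_eq_mul, card_signs] at h1
  rw [signAverage, one_div, inv_mul_le_iff₀ (by positivity)]
  exact h1

theorem cast_units_sq (u : ℤˣ) : (((u : ℤˣ) : ℤ) : ℝ) ^ 2 = 1 := by
  rcases Int.units_eq_one_or u with h | h <;> simp [h]

theorem sum_signs_mul_le {n : ℕ} (σ : Fin n → ℤˣ) (v : EuclideanSpace ℝ (Fin n)) :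
    ∑ i, (((σ i : ℤˣ) : ℤ) : ℝ) * v i ≤ Real.sqrt n * ‖v‖ := by
  have h := Finset.sum_mul_sq_le_sq_mul_sq Finset.univ (fun i => (((σ i : ℤˣ) : ℤ) : ℝ)) fun i => v i
  simp only [cast_units_sq, Finset.sum_const, Finset.card_univ, Fintype.card_fin, nsmul_eq_mul,
    mul_one] at h
  rw [EuclideanSpace.norm_eq, ← Real.sqrt_mul (Nat.cast_nonneg _)]
  refine Real.le_sqrt_of_sq_le (h.trans_eq ?_)
  simp

theorem sum_exp_signs_le {n : ℕ} (v : EuclideanSpace ℝ (Fin n)) :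
    ∑ σ : Fin n → ℤˣ, Real.exp (∑ i, (((σ i : ℤˣ) : ℤ) : ℝ) * v i) ≤
      2 ^ n * Real.exp (‖v‖ ^ 2 / 2) := by
  have h1 : ∀ i, ∑ u : ℤˣ, Real.exp (((u : ℤ) : ℝ) * v i) = 2 * Real.cosh (v i) := by
    intro i
    rw [show (Finset.univ : Finset ℤˣ) = {1, -1} from rfl,
      Finset.sum_pair (by decide), Real.cosh_eq]
    push_cast
    rw [one_mul, neg_one_mul]
    ring
  calc ∑ σ : Fin n → ℤˣ, Real.exp (∑ i, (((σ i : ℤˣ) : ℤ) : ℝ) * v i)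
      = ∏ i, (2 * Real.cosh (v i)) := by
        simp_rw [← h1, Real.exp_sum]
        rw [Fintype.prod_sum]
    _ ≤ ∏ i, (2 * Real.exp ((v i) ^ 2 / 2)) := by
        refine Finset.prod_le_prod (fun i _ => by positivity) fun i _ => ?_
        gcongr
        exact Real.cosh_le_exp_half_sq _
    _ = 2 ^ n * Real.exp (‖v‖ ^ 2 / 2) := by
        rw [Finset.prod_mul_distrib, ← Real.exp_sum, ← Finset.sum_div, EuclideanSpace.real_norm_sq_eq]
        simp

theorem signAverage_const {n : ℕ} (v : EuclideanSpace ℝ (Fin n)) :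
    signAverage (fun _ => v) = 0 := by
  have h : ∑ σ : Fin n → ℤˣ, ∑ i, (((σ i : ℤˣ) : ℤ) : ℝ) * v i =
      -∑ σ : Fin n → ℤˣ, ∑ i, (((σ i : ℤˣ) : ℤ) : ℝ) * v i := by
    rw [← Finset.sum_neg_distrib]
    refine Fintype.sum_equiv (Equiv.neg (Fin n → ℤˣ)) _ _ fun σ => ?_
    simp
  rw [signAverage, show ∑ σ : Fin n → ℤˣ, ∑ i, (((σ i : ℤˣ) : ℤ) : ℝ) * v i = 0 by linarith,
    mul_zero]

/-- Massart's finite class lemma, for a selection of vectors in a finite set. -/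
theorem signAverage_le_of_mem {n : ℕ} {A : Finset (EuclideanSpace ℝ (Fin n))} {r L : ℝ}
    (hr : 0 < r) (hL : 0 < L) (hA : ∀ a ∈ A, ‖a‖ ≤ r) (hc : Real.log A.card ≤ L)
    (s : (Fin n → ℤˣ) → EuclideanSpace ℝ (Fin n)) (hs : ∀ σ, s σ ∈ A) :
    signAverage s ≤ r * Real.sqrt (2 * L) := by
  have hA0 : 0 < A.card := Finset.card_pos.2 ⟨_, hs 1⟩
  -- The value that equates the two contributions: `(l r)² / 2 = L`.
  set l := Real.sqrt (2 * L) / r with hl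
  have hl0 : 0 < l := by positivity
  have hl2 : (l * r) ^ 2 = 2 * L := by
    rw [hl, div_mul_cancel₀ _ hr.ne', Real.sq_sqrt (by positivity)]
  have h1 : Real.exp (l * signAverage s) ≤ Real.exp (L + L) := by
    calc Real.exp (l * signAverage s)
        = Real.exp (∑ σ : Fin n → ℤˣ, (1 / (2 : ℝ) ^ n) •
            (l * ∑ i, (((σ i : ℤˣ) : ℤ) : ℝ) * s σ i)) := by
          congr 1
          simp_rw [smul_eq_mul]
          rw [← Finset.mul_sum, ← Finset.mul_sum, signAverage]
          ring
      _ ≤ ∑ σ : Fin n → ℤˣ, (1 / (2 : ℝ) ^ n) •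
            Real.exp (l * ∑ i, (((σ i : ℤˣ) : ℤ) : ℝ) * s σ i) := by
          refine convexOn_exp.map_sum_le (fun _ _ => by positivity) ?_ fun _ _ => Set.mem_univ _
          rw [Finset.sum_const, nsmul_eq_mul, card_signs]
          field_simp
      _ ≤ ∑ σ : Fin n → ℤˣ, (1 / (2 : ℝ) ^ n) *
            ∑ a ∈ A, Real.exp (∑ i, (((σ i : ℤˣ) : ℤ) : ℝ) * (l • a) i) := by
          refine Finset.sum_le_sum fun σ _ => ?_
          rw [smul_eq_mul]
          gcongr
          refine le_trans (le_of_eq ?_) (Finset.single_le_sum (fun _ _ => (Real.exp_pos _).le) (hs σ))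
          rw [Finset.mul_sum]
          congr 1
          refine Finset.sum_congr rfl fun i _ => ?_
          rw [PiLp.smul_apply, smul_eq_mul]
          ring
      _ = (1 / (2 : ℝ) ^ n) * ∑ a ∈ A, ∑ σ : Fin n → ℤˣ,
            Real.exp (∑ i, (((σ i : ℤˣ) : ℤ) : ℝ) * (l • a) i) := by
          rw [← Finset.mul_sum, Finset.sum_comm]
      _ ≤ (1 / (2 : ℝ) ^ n) * ∑ a ∈ A, 2 ^ n * Real.exp L := by
          gcongr with a ha
          refine (sum_exp_signs_le _).trans ?_
          gcongr
          have h3 : ‖l • a‖ ≤ l * r := by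
            rw [norm_smul, Real.norm_of_nonneg hl0.le]
            exact mul_le_mul_of_nonneg_left (hA a ha) hl0.le
          have h4 : ‖l • a‖ ^ 2 ≤ (l * r) ^ 2 := by gcongr
          linarith
      _ = A.card * Real.exp L := by
          rw [Finset.sum_const, nsmul_eq_mul]
          field_simp
      _ ≤ Real.exp L * Real.exp L := by
          gcongr
          exact (Real.log_le_iff_le_exp (by exact_mod_cast hA0)).1 hc
      _ = Real.exp (L + L) := (Real.exp_add _ _).symm
  rw [Real.exp_le_exp] at h1
  have h2 : l * signAverage s ≤ l * (r * Real.sqrt (2 * L)) := by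
    refine h1.trans_eq ?_
    have h3 : l * (r * Real.sqrt (2 * L)) = Real.sqrt (2 * L) * Real.sqrt (2 * L) := by
      rw [hl]
      field_simp
    rw [h3, Real.mul_self_sqrt (by positivity)]
    ring
  exact le_of_mul_le_mul_left h2 hl0

/-- Chaining: a selection of elements of a class with small nets at the scales `h 1, …, h N`. -/
theorem signAverage_le_chaining {n : ℕ} (hn : 0 < n)
    (s : (Fin n → ℤˣ) → EuclideanSpace ℝ (Fin n)) (F : Set (EuclideanSpace ℝ (Fin n)))
    (hs : ∀ σ, s σ ∈ F) (N : ℕ) (h : ℕ → ℝ) (hpos : ∀ j, 0 < h j)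
    (hdiam : ∀ f ∈ F, ∀ g ∈ F, ‖f - g‖ ≤ Real.sqrt n * h 0) (H : ℕ → ℝ)
    (hH : ∀ j < N, 0 < H j) (hmono : ∀ j, j + 1 < N → H j ≤ H (j + 1))
    (hnet : ∀ j < N, ∃ A : Finset (EuclideanSpace ℝ (Fin n)), Real.log A.card ≤ H j ∧
      ∀ f ∈ F, ∃ g ∈ A, ‖f - g‖ ≤ Real.sqrt n * h (j + 1)) :
    signAverage s ≤ n * (h N + 2 * ∑ j ∈ Finset.range N,
      (h (j + 1) + h j) * Real.sqrt (H j / n)) := by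
  classical
  have hn' : (0 : ℝ) < n := by exact_mod_cast hn
  -- The coarsest net is one point of the class, adequate because `h 0` dominates the diameter; its
  -- sign average vanishes. By monotonicity `H j` bounds the entropy of both ends of link `j`.
  obtain ⟨B, hB0, hB1, hB2, hB⟩ : ∃ B : ℕ → Finset (EuclideanSpace ℝ (Fin n)), B 0 = {s 1} ∧
      (∀ j < N, Real.log (B j).card ≤ H j) ∧ (∀ j < N, Real.log (B (j + 1)).card ≤ H j) ∧
      ∀ j ≤ N, ∀ f ∈ F, ∃ g ∈ B j, ‖f - g‖ ≤ Real.sqrt n * h j := by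
    choose! A hA1 hA2 using hnet
    refine ⟨fun j => Nat.casesOn j {s 1} A, rfl, ?_, hA1, ?_⟩
    · rintro (_ | j) hj
      · simpa using (hH 0 hj).le
      · exact (hA1 j (by lia)).trans (hmono j hj)
    · rintro (_ | j) hj f hf
      · exact ⟨s 1, by simp, hdiam f hf _ (hs 1)⟩
      · exact hA2 j hj f hf
  choose! p hpB hp using hB
  have hp0 : ∀ σ, p 0 (s σ) = s 1 := fun σ => by
    have := hpB 0 (Nat.zero_le _) (s σ) (hs σ)
    rw [hB0] at this
    exact Finset.mem_singleton.1 this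
  have hchain : ∀ k ≤ N, signAverage (fun σ => p k (s σ)) ≤
      n * (2 * ∑ j ∈ Finset.range k, (h (j + 1) + h j) * Real.sqrt (H j / n)) := by
    intro k
    induction k with
    | zero =>
      intro _
      simp only [hp0, signAverage_const]
      simp
    | succ k ih =>
      intro hk
      have ih := ih (by lia)
      have hsplit : signAverage (fun σ => p (k + 1) (s σ)) =
          signAverage (fun σ => p k (s σ)) +
            signAverage (fun σ => p (k + 1) (s σ) - p k (s σ)) := by
        rw [← signAverage_add]
        congr 1
        ext1 σ
        abel
      set r := Real.sqrt n * (h (k + 1) + h k) with hr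
      set D := ((B (k + 1) ×ˢ B k).image fun q => q.1 - q.2).filter fun a => ‖a‖ ≤ r with hD
      have hmem : ∀ σ, p (k + 1) (s σ) - p k (s σ) ∈ D := by
        intro σ
        refine Finset.mem_filter.2 ⟨Finset.mem_image.2 ⟨(p (k + 1) (s σ), p k (s σ)),
          Finset.mem_product.2 ⟨hpB _ hk _ (hs σ), hpB _ (by lia) _ (hs σ)⟩, rfl⟩, ?_⟩
        calc ‖p (k + 1) (s σ) - p k (s σ)‖
            = ‖(s σ - p k (s σ)) - (s σ - p (k + 1) (s σ))‖ := by congr 1; abel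
          _ ≤ ‖s σ - p k (s σ)‖ + ‖s σ - p (k + 1) (s σ)‖ := norm_sub_le _ _
          _ ≤ Real.sqrt n * h k + Real.sqrt n * h (k + 1) :=
              add_le_add (hp _ (by lia) _ (hs σ)) (hp _ hk _ (hs σ))
          _ = r := by rw [hr]; ring
      have hc : Real.log D.card ≤ 2 * H k := by
        have h1 : (0 : ℝ) < D.card := by exact_mod_cast Finset.card_pos.2 ⟨_, hmem 1⟩
        have h2 : (D.card : ℝ) ≤ (B (k + 1)).card * (B k).card := by
          have := (Finset.card_filter_le ((B (k + 1) ×ˢ B k).image fun q => q.1 - q.2)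
            fun a => ‖a‖ ≤ r).trans Finset.card_image_le
          rw [Finset.card_product] at this
          exact_mod_cast this
        have h3 : ((B (k + 1)).card : ℝ) ≠ 0 := by
          exact_mod_cast (Finset.card_pos.2 ⟨_, hpB _ hk _ (hs 1)⟩).ne'
        have h4 : ((B k).card : ℝ) ≠ 0 := by
          exact_mod_cast (Finset.card_pos.2 ⟨_, hpB k (by lia) _ (hs 1)⟩).ne'
        refine (Real.log_le_log h1 h2).trans ?_
        rw [Real.log_mul h3 h4]
        linarith [hB1 k (by lia), hB2 k (by lia)]
      have hHk := hH k (by lia)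
      have hmas := signAverage_le_of_mem
        (mul_pos (Real.sqrt_pos.2 hn') (add_pos (hpos (k + 1)) (hpos k))) (by positivity)
        (fun a ha => (Finset.mem_filter.1 ha).2) hc _ hmem
      have heq : Real.sqrt n * (h (k + 1) + h k) * Real.sqrt (2 * (2 * H k)) =
          n * (2 * ((h (k + 1) + h k) * Real.sqrt (H k / n))) := by
        have h5 : Real.sqrt (2 * (2 * H k)) = 2 * Real.sqrt (H k) := by
          rw [show 2 * (2 * H k) = 2 ^ 2 * H k by ring, Real.sqrt_mul (by positivity),
            Real.sqrt_sq (by norm_num)]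
        have h6 : (n : ℝ) * Real.sqrt (H k / n) = Real.sqrt n * Real.sqrt (H k) := by
          rw [Real.sqrt_div hHk.le]
          nth_rewrite 1 [← Real.mul_self_sqrt hn'.le]
          field_simp
        calc _ = 2 * (h (k + 1) + h k) * (Real.sqrt n * Real.sqrt (H k)) := by rw [h5]; ring
          _ = _ := by rw [← h6]; ring
      rw [heq] at hmas
      rw [hsplit, Finset.sum_range_succ]
      linarith
  have hsplit : signAverage s = signAverage (fun σ => p N (s σ)) +
      signAverage (fun σ => s σ - p N (s σ)) := by
    rw [← signAverage_add]
    congr 1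
    ext1 σ
    abel
  have hrest : signAverage (fun σ => s σ - p N (s σ)) ≤ n * h N := by
    refine signAverage_le _ fun σ => (sum_signs_mul_le σ _).trans ?_
    calc Real.sqrt n * ‖s σ - p N (s σ)‖ ≤ Real.sqrt n * (Real.sqrt n * h N) := by
          gcongr
          exact hp N le_rfl _ (hs σ)
      _ = n * h N := by rw [← mul_assoc, Real.mul_self_sqrt hn'.le]
  rw [hsplit]
  linarith [hchain N le_rfl]

/-- A bound on the averages over signs of all selections bounds the Rademacher complexity. -/
theorem rademacherComplexity_le {T : Type*} [MeasurableSpace T] (P : Measure T)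
    [IsProbabilityMeasure P] {n : ℕ} (hn : 0 < n) (F : Set (T → ℝ)) {B : ℝ} (hB : 0 ≤ B)
    (h : ∀ z : Fin n → T, ∀ f : (Fin n → ℤˣ) → T → ℝ, (∀ σ, f σ ∈ F) →
      signAverage (fun σ => WithLp.toLp 2 fun i => f σ (z i)) ≤ n * B) :
    rademacherComplexity P n F ≤ (B : EReal) := by
  have hn' : (0 : ℝ) < n := by exact_mod_cast hn
  refine iSup_le fun S => iSup_le fun hS => iSup_le fun hSF => ?_
  rw [EReal.coe_le_coe_iff]
  have hpt : ∀ t : Fin n → T, (1 / (2 : ℝ) ^ n) * ∑ σ : Fin n → ℤˣ,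
      S.sup' hS (fun f => (1 / (n : ℝ)) * ∑ i, (((σ i : ℤˣ) : ℤ) : ℝ) * f (t i)) ≤ B := by
    intro t
    -- Selecting a maximizer for each sign vector replaces the maximum by a sign average.
    have hsel : ∀ σ : Fin n → ℤˣ, ∃ f ∈ S,
        S.sup' hS (fun f => (1 / (n : ℝ)) * ∑ i, (((σ i : ℤˣ) : ℤ) : ℝ) * f (t i)) =
        (1 / (n : ℝ)) * ∑ i, (((σ i : ℤˣ) : ℤ) : ℝ) * f (t i) := fun σ =>
      Finset.exists_mem_eq_sup' hS _
    choose f hfS hf using hsel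
    have h1 := h t f fun σ => hSF (hfS σ)
    rw [signAverage] at h1
    simp_rw [hf]
    rw [← Finset.mul_sum, mul_left_comm, one_div (n : ℝ), inv_mul_le_iff₀ hn']
    exact h1
  by_cases hint : Integrable (fun t : Fin n → T => (1 / (2 : ℝ) ^ n) * ∑ σ : Fin n → ℤˣ,
      S.sup' hS (fun f => (1 / (n : ℝ)) * ∑ i, (((σ i : ℤˣ) : ℤ) : ℝ) * f (t i)))
      (Measure.pi fun _ : Fin n => P)
  · calc _ ≤ ∫ _ : Fin n → T, B ∂(Measure.pi fun _ : Fin n => P) :=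
          integral_mono hint (integrable_const B) hpt
      _ = B := by simp
  -- A non-integrable integrand has integral 0 by convention, whence the need for `0 ≤ B`.
  · rw [integral_undef hint]
    exact hB

/-! ### Margin functions -/

theorem squash_eq {γ : ℝ} (hγ : 0 < γ) (t : ℝ) : squash γ t = max 0 (min t γ) := by
  unfold squash
  rcases le_or_gt t 0 with h | h
  · rw [if_neg (by intro h'; linarith [h'.1]), if_neg (by linarith), min_eq_left (by linarith),
      max_eq_left h, add_zero]
  · rcases le_or_gt t γ with h' | h'
    · rw [if_pos ⟨h, h'⟩, if_neg (by linarith), min_eq_left h', max_eq_right h.le, add_zero]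
    · rw [if_neg (by intro h''; linarith [h''.2]), if_pos h', min_eq_right h'.le,
        max_eq_right hγ.le, zero_add]

theorem squash_mem_Icc {γ : ℝ} (hγ : 0 < γ) (t : ℝ) : squash γ t ∈ Set.Icc 0 γ := by
  rw [squash_eq hγ]
  exact ⟨le_max_left _ _, max_le hγ.le (min_le_right _ _)⟩

theorem abs_squash_sub_le {γ : ℝ} (hγ : 0 < γ) (s t : ℝ) :
    |squash γ s - squash γ t| ≤ |s - t| := by
  rw [squash_eq hγ, squash_eq hγ]
  refine (abs_max_sub_max_le_max _ _ _ _).trans ?_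
  rw [sub_self, abs_zero]
  refine max_le (abs_nonneg _) ((abs_min_sub_min_le_max _ _ _ _).trans ?_)
  simp

/-- The component and the maximum of the others each move by at most `δ`, and the factor `1 / 2`
compensates for the two. The assumption `2 ≤ C` makes the index set of that maximum nonempty. -/
theorem abs_marginFun_sub_le {X : Type*} {C : ℕ} (hC : 2 ≤ C) (g g' : Fin C → X → ℝ)
    (z : X × Fin C) {δ : ℝ} (h : ∀ k, |g k z.1 - g' k z.1| ≤ δ) :
    |marginFun g z - marginFun g' z| ≤ δ := by
  have : Nonempty {l : Fin C // l ≠ z.2} := by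
    have : Nontrivial (Fin C) := Fin.nontrivial_iff_two_le.2 hC
    obtain ⟨l, hl⟩ := exists_ne z.2
    exact ⟨⟨l, hl⟩⟩
  have hsup : ∀ u v : Fin C → X → ℝ, (∀ k, |u k z.1 - v k z.1| ≤ δ) →
      (⨆ l : {l : Fin C // l ≠ z.2}, u l z.1) ≤ (⨆ l : {l : Fin C // l ≠ z.2}, v l z.1) + δ := by
    intro u v huv
    refine ciSup_le fun l => ?_
    have h1 : v l z.1 ≤ ⨆ l : {l : Fin C // l ≠ z.2}, v l z.1 :=
      le_ciSup (f := fun l : {l : Fin C // l ≠ z.2} => v l z.1) (Set.finite_range _).bddAbove l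
    linarith [(abs_le.1 (huv l)).2]
  have h1 := hsup g g' h
  have h2 := hsup g' g fun k => by rw [abs_sub_comm]; exact h k
  have h3 := abs_le.1 (h z.2)
  unfold marginFun
  rw [abs_le]
  constructor <;> linarith [h3.1, h3.2]

/-- Passing from the maximum over the categories to a sum of squares lets the sums over sample and
categories be exchanged; this costs the factor `√C` in the scale of the nets. -/
theorem sq_squash_marginFun_sub_le {X : Type*} {C : ℕ} (hC : 2 ≤ C) {γ : ℝ} (hγ : 0 < γ)
    (g g' : Fin C → X → ℝ) (z : X × Fin C) :
    (squash γ (marginFun g z) - squash γ (marginFun g' z)) ^ 2 ≤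
      ∑ k, (g k z.1 - g' k z.1) ^ 2 := by
  have h1 := (abs_squash_sub_le hγ (marginFun g z) (marginFun g' z)).trans
    (abs_marginFun_sub_le hC g g' z (δ := Real.sqrt (∑ k, (g k z.1 - g' k z.1) ^ 2)) fun k =>
      Real.abs_le_sqrt (Finset.single_le_sum (f := fun k => (g k z.1 - g' k z.1) ^ 2)
        (fun _ _ => sq_nonneg _) (Finset.mem_univ k)))
  rw [← sq_abs]
  calc _ ≤ Real.sqrt (∑ k, (g k z.1 - g' k z.1) ^ 2) ^ 2 := by gcongr
    _ = _ := Real.sq_sqrt (Finset.sum_nonneg fun _ _ => sq_nonneg _)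

/-- The vector of the values taken on a sample. -/
noncomputable def sampleVec {T : Type*} {n : ℕ} (z : Fin n → T) (f : T → ℝ) :
    EuclideanSpace ℝ (Fin n) :=
  WithLp.toLp 2 fun i => f (z i)

theorem norm_sampleVec_sub_sq {T : Type*} {n : ℕ} (z : Fin n → T) (f g : T → ℝ) :
    ‖sampleVec z f - sampleVec z g‖ ^ 2 = ∑ i, (f (z i) - g (z i)) ^ 2 := by
  rw [EuclideanSpace.real_norm_sq_eq]
  rfl

/-- Nets of the class of squashed margin functions, from nets of the component classes. -/
theorem exists_net_squashedMarginClass {X : Type*} {C n : ℕ} (hC : 2 ≤ C) (hn : 0 < n)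
    (z : Fin n → X × Fin C) {M ε V γ : ℝ} (hγ : 0 < γ) (hε : 0 < ε) (hεM : ε ≤ M) (hV : 0 < V)
    (G : Fin C → Set (X → ℝ)) (hM : ∀ k, ∀ f ∈ G k, ∀ t, f t ∈ Set.Icc (-M) M)
    (hdim : ∀ k, ∀ s : Finset X, s.Nonempty →
      IsFatShattered (Set.Icc (-M) M) (G k) (ε / 96) s → (s.card : ℝ) ≤ V) :
    ∃ A : Finset (EuclideanSpace ℝ (Fin n)),
      Real.log A.card ≤ C * (20 * V * Real.log (14 * M / ε)) ∧
      ∀ f ∈ sampleVec z '' squashedMarginClass G γ, ∃ a ∈ A,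
        ‖f - a‖ ≤ Real.sqrt n * (Real.sqrt C * ε) := by
  classical
  have hlog : 0 ≤ Real.log (14 * M / ε) := by
    refine Real.log_nonneg ((one_le_div hε).2 ?_)
    linarith
  choose A hAG hAc hA using fun k => exists_net hn (fun i => (z i).1) hε hεM hV (hM k) (hdim k)
  refine ⟨(Fintype.piFinset A).image fun g => sampleVec z (squash γ ∘ marginFun g), ?_, ?_⟩
  · have h1 : ((((Fintype.piFinset A).image fun g =>
        sampleVec z (squash γ ∘ marginFun g)).card : ℕ) : ℝ) ≤ ∏ k, ((A k).card : ℝ) := by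
      have := Finset.card_image_le (s := Fintype.piFinset A)
        (f := fun g => sampleVec z (squash γ ∘ marginFun g))
      rw [Fintype.card_piFinset] at this
      exact_mod_cast this
    rcases Nat.eq_zero_or_pos ((Fintype.piFinset A).image fun g =>
        sampleVec z (squash γ ∘ marginFun g)).card with h0 | h0
    · rw [h0, Nat.cast_zero, Real.log_zero]
      positivity
    · have h2 : ∀ k ∈ Finset.univ, ((A k).card : ℝ) ≠ 0 := by
        rw [← Finset.prod_ne_zero_iff]
        exact (lt_of_lt_of_le (by exact_mod_cast h0) h1).ne'
      refine (Real.log_le_log (by exact_mod_cast h0) h1).trans ?_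
      rw [Real.log_prod h2]
      refine (Finset.sum_le_sum fun k _ => hAc k).trans_eq ?_
      simp
  · rintro _ ⟨_, ⟨g, hg, rfl⟩, rfl⟩
    choose g' hg'A hg' using fun k => hA k (g k) (hg k)
    refine ⟨_, Finset.mem_image_of_mem _ (Fintype.mem_piFinset.2 hg'A), ?_⟩
    refine abs_le_of_sq_le_sq' ?_ (by positivity) |>.2
    rw [norm_sampleVec_sub_sq]
    calc ∑ i, ((squash γ ∘ marginFun g) (z i) - (squash γ ∘ marginFun g') (z i)) ^ 2
        ≤ ∑ i, ∑ k, (g k (z i).1 - g' k (z i).1) ^ 2 :=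
          Finset.sum_le_sum fun i _ => sq_squash_marginFun_sub_le hC hγ g g' (z i)
      _ = ∑ k, ∑ i, (g k (z i).1 - g' k (z i).1) ^ 2 := Finset.sum_comm
      _ ≤ ∑ _k : Fin C, n * ε ^ 2 := Finset.sum_le_sum fun k _ => hg' k
      _ = (Real.sqrt n * (Real.sqrt C * ε)) ^ 2 := by
          rw [mul_pow, mul_pow, Real.sq_sqrt (Nat.cast_nonneg _), Real.sq_sqrt (Nat.cast_nonneg _)]
          simp
          ring

theorem card_le_of_fatDim_le {X : Type*} {C : ℕ} {M K : ℝ} {d : ℕ} (G : Fin C → Set (X → ℝ))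
    (hdim : ∀ ε : ℝ, 0 < ε → ε ≤ M →
      (((⨆ k : Fin C, fatDim (Set.Icc (-M) M) (G k) ε) : ℕ∞) : ℝ≥0∞)
        ≤ ENNReal.ofReal (K * (1 / ε ^ d))) (hK : 0 < K) {ε : ℝ} (hε : 0 < ε) (hεM : ε ≤ M)
    (k : Fin C) (s : Finset X) (hs : s.Nonempty)
    (hsh : IsFatShattered (Set.Icc (-M) M) (G k) ε s) : (s.card : ℝ) ≤ K * (1 / ε ^ d) := by
  have h1 : (s.card : ℕ∞) ≤ ⨆ k : Fin C, fatDim (Set.Icc (-M) M) (G k) ε :=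
    le_trans (le_iSup₂ (f := fun (s : Finset X) (_ : s.Nonempty ∧
      IsFatShattered (Set.Icc (-M) M) (G k) ε s) => (s.card : ℕ∞)) s ⟨hs, hsh⟩)
      (le_iSup (fun k => fatDim (Set.Icc (-M) M) (G k) ε) k)
  have h2 : ((s.card : ℕ) : ℝ≥0∞) ≤ ENNReal.ofReal (K * (1 / ε ^ d)) := by
    refine le_trans ?_ (hdim ε hε hεM)
    exact_mod_cast h1
  rw [← ENNReal.ofReal_natCast, ENNReal.ofReal_le_ofReal_iff (by positivity)] at h2
  exact h2

/-- Chaining bound on the Rademacher complexity of the class of squashed margin functions. -/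
theorem rademacherComplexity_squashedMarginClass_le {X : Type*} [MeasurableSpace X] {C m : ℕ}
    (hC : 2 ≤ C) (hm : 0 < m) (P : Measure (X × Fin C)) [IsProbabilityMeasure P] {M : ℝ}
    (G : Fin C → Set (X → ℝ)) (hM : ∀ k, ∀ f ∈ G k, ∀ x, f x ∈ Set.Icc (-M) M) {d : ℕ} {K : ℝ}
    (hK : 0 < K)
    (hdim : ∀ ε : ℝ, 0 < ε → ε ≤ M →
      (((⨆ k : Fin C, fatDim (Set.Icc (-M) M) (G k) ε) : ℕ∞) : ℝ≥0∞)
        ≤ ENNReal.ofReal (K * (1 / ε ^ d)))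
    {γ : ℝ} (hγ : 0 < γ) (N : ℕ) (h : ℕ → ℝ) (hpos : ∀ j, 0 < h j) (hh0 : γ ≤ h 0)
    (hanti : Antitone h) (hhM : ∀ j < N, h (j + 1) ≤ Real.sqrt C * M) :
    rademacherComplexity P m (squashedMarginClass G γ) ≤
      ((h N + 2 * ∑ j ∈ Finset.range N, (h (j + 1) + h j) *
        Real.sqrt (C * (20 * (K * (96 * Real.sqrt C / h (j + 1)) ^ d) *
          Real.log (14 * M * Real.sqrt C / h (j + 1))) / m) : ℝ) : EReal) := by
  have hC0 : (0 : ℝ) < C := by exact_mod_cast (by lia : 0 < C)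
  have hsC : 0 < Real.sqrt C := Real.sqrt_pos.2 hC0
  have harg : ∀ j < N, 14 ≤ 14 * M * Real.sqrt C / h (j + 1) := by
    intro j hj
    rw [le_div_iff₀ (hpos _)]
    linarith [hhM j hj]
  refine rademacherComplexity_le P hm _ (by
    have := hpos
    refine add_nonneg (hpos N).le (mul_nonneg (by norm_num) (Finset.sum_nonneg fun j _ => ?_))
    have h1 := hpos j
    have h2 := hpos (j + 1)
    positivity) fun z f hf => ?_
  refine signAverage_le_chaining hm _ (sampleVec z '' squashedMarginClass G γ)
    (fun σ => Set.mem_image_of_mem _ (hf σ)) N h hpos ?_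
    (fun j => C * (20 * (K * (96 * Real.sqrt C / h (j + 1)) ^ d) *
          Real.log (14 * M * Real.sqrt C / h (j + 1)))) ?_ ?_ ?_
  · rintro _ ⟨_, ⟨g, -, rfl⟩, rfl⟩ _ ⟨_, ⟨g', -, rfl⟩, rfl⟩
    refine (abs_le_of_sq_le_sq' ?_ (mul_nonneg (Real.sqrt_nonneg _) (hpos 0).le)).2
    rw [norm_sampleVec_sub_sq, mul_pow, Real.sq_sqrt (Nat.cast_nonneg _)]
    calc ∑ i, ((squash γ ∘ marginFun g) (z i) - (squash γ ∘ marginFun g') (z i)) ^ 2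
        ≤ ∑ _i : Fin m, h 0 ^ 2 := by
          refine Finset.sum_le_sum fun i _ => ?_
          have h1 := squash_mem_Icc hγ (marginFun g (z i))
          have h2 := squash_mem_Icc hγ (marginFun g' (z i))
          refine sq_le_sq' ?_ ?_ <;> simp only [Function.comp_apply] <;>
            linarith [h1.1, h1.2, h2.1, h2.2]
      _ = m * h 0 ^ 2 := by simp
  · intro j hj
    have h1 : 0 < Real.log (14 * M * Real.sqrt C / h (j + 1)) :=
      Real.log_pos (by linarith [harg j hj])
    have h2 := hpos (j + 1)
    positivity
  · intro j hj
    have h1 := hpos (j + 1)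
    have h2 := hpos (j + 1 + 1)
    have h3 : h (j + 1 + 1) ≤ h (j + 1) := hanti (by lia)
    have h4 := harg j (by lia)
    have h5 : 0 ≤ 14 * M * Real.sqrt C := by
      by_contra! hneg
      linarith [div_neg_of_neg_of_pos hneg h1]
    have h6 : 0 ≤ Real.log (14 * M * Real.sqrt C / h (j + 1)) := Real.log_nonneg (by linarith)
    gcongr
  · intro j hj
    have h1 := hpos (j + 1)
    have hε : 0 < h (j + 1) / Real.sqrt C := by positivity
    have hεM : h (j + 1) / Real.sqrt C ≤ M := by
      rw [div_le_iff₀ hsC]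
      linarith [hhM j hj]
    have hV : (K * (1 / (h (j + 1) / Real.sqrt C / 96) ^ d)) =
        K * (96 * Real.sqrt C / h (j + 1)) ^ d := by
      rw [← one_div_pow]
      congr 2
      field_simp
    obtain ⟨A, hA1, hA2⟩ := exists_net_squashedMarginClass hC hm z hγ hε hεM
      (by positivity : 0 < K * (1 / (h (j + 1) / Real.sqrt C / 96) ^ d)) G hM
      fun k => card_le_of_fatDim_le G hdim hK (by positivity) (by linarith) k
    refine ⟨A, ?_, ?_⟩
    · rw [hV] at hA1
      rwa [div_div_eq_mul_div] at hA1
    · rwa [mul_div_cancel₀ _ hsC.ne'] at hA2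

/-! ### The error function and an entropy integral -/

theorem hasDerivAt_erf (t : ℝ) :
    HasDerivAt erf ((2 / Real.sqrt Real.pi) * Real.exp (-t ^ 2)) t := by
  have hc : Continuous fun u : ℝ => Real.exp (-u ^ 2) := by fun_prop
  exact (hc.integral_hasStrictDerivAt 0 t).hasDerivAt.const_mul _

theorem erf_le_one {t : ℝ} (ht : 0 ≤ t) : erf t ≤ 1 := by
  have h1 : ∫ u in (0 : ℝ)..t, Real.exp (-u ^ 2) ≤ Real.sqrt Real.pi / 2 := by
    have h2 := integral_gaussian_Ioi 1
    have h3 := (integrable_exp_neg_mul_sq one_pos)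
    simp only [neg_mul, one_mul, div_one] at h2 h3
    rw [intervalIntegral.integral_of_le ht, ← h2]
    exact setIntegral_mono_set h3.integrableOn (ae_of_all _ fun _ => (Real.exp_pos _).le)
      (ae_of_all _ Set.Ioc_subset_Ioi_self)
  have hpi : 0 < Real.sqrt Real.pi := Real.sqrt_pos.2 Real.pi_pos
  calc erf t ≤ (2 / Real.sqrt Real.pi) * (Real.sqrt Real.pi / 2) := by
        unfold erf
        gcongr
    _ = 1 := by field_simp

/-- A primitive of `y ↦ √(2 log (F / y))`. -/
noncomputable def entropyPrimitive (F y : ℝ) : ℝ :=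
  y * (Real.sqrt 2 * Real.sqrt (Real.log (F / y))) +
    Real.sqrt (Real.pi / 2) * F * (1 - erf (Real.sqrt (Real.log (F / y))))

theorem entropyPrimitive_nonneg {F y : ℝ} (hF : 0 ≤ F) (hy : 0 ≤ y) : 0 ≤ entropyPrimitive F y := by
  have h := erf_le_one (Real.sqrt_nonneg (Real.log (F / y)))
  refine add_nonneg (by positivity) (mul_nonneg (by positivity) (by linarith))

theorem hasDerivAt_entropyPrimitive {F y : ℝ} (hy : 0 < y) (hyF : y < F) :
    HasDerivAt (entropyPrimitive F) (Real.sqrt 2 * Real.sqrt (Real.log (F / y))) y := by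
  have hF : 0 < F := hy.trans hyF
  have hw : 0 < Real.log (F / y) := Real.log_pos ((one_lt_div hy).2 hyF)
  set s := Real.sqrt (Real.log (F / y)) with hs
  have hs0 : 0 < s := Real.sqrt_pos.2 hw
  have hd1 : HasDerivAt (fun y => Real.log (F / y)) (-1 / y) y := by
    have h1 : HasDerivAt (fun y : ℝ => F / y) (F * (-(y ^ 2)⁻¹)) y := by
      simpa [div_eq_mul_inv] using (hasDerivAt_inv hy.ne').const_mul F
    convert h1.log (by positivity) using 1
    field_simp
  have hd2 : HasDerivAt (fun y => Real.sqrt (Real.log (F / y))) (-1 / y / (2 * s)) y :=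
    hd1.sqrt hw.ne'
  have hd3 := ((hasDerivAt_id y).mul (hd2.const_mul (Real.sqrt 2))).add
    ((((hasDerivAt_erf s).comp y hd2).const_sub 1).const_mul (Real.sqrt (Real.pi / 2) * F))
  -- This makes the derivative of the `erf` term cancel the one from differentiating the square
  -- root.
  have hexp : Real.exp (-s ^ 2) = y / F := by
    rw [hs, Real.sq_sqrt hw.le, Real.exp_neg, Real.exp_log (by positivity), inv_div]
  have hpi : 0 < Real.sqrt Real.pi := Real.sqrt_pos.2 Real.pi_pos
  have h2 : Real.sqrt 2 ^ 2 = 2 := Real.sq_sqrt (by norm_num)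
  have h20 : 0 < Real.sqrt 2 := by positivity
  refine HasDerivAt.congr_deriv hd3 ?_
  rw [hexp, Real.sqrt_div Real.pi_pos.le]
  simp only [id]
  field_simp
  rw [h2]
  ring

/-- Lower Riemann sum on dyadic intervals: `y ↦ √(2 log (F / y))` decreases, and its value at the
right end of `[2^(-j-1), 2^(-j)]` is the summand. The mean value theorem for the primitive replaces
integration. -/
theorem sum_sqrt_log_le {F : ℝ} (hF : 1 < F) (N : ℕ) :
    ∑ j ∈ Finset.range N, (1 / 2 : ℝ) ^ (j + 1) * Real.sqrt (2 * Real.log (F * 2 ^ j)) ≤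
      entropyPrimitive F 1 := by
  suffices h : ∑ j ∈ Finset.range N, (1 / 2 : ℝ) ^ (j + 1) * Real.sqrt (2 * Real.log (F * 2 ^ j)) ≤
      entropyPrimitive F 1 - entropyPrimitive F ((1 / 2) ^ N) by
    linarith [entropyPrimitive_nonneg (by linarith : 0 ≤ F) (by positivity : (0 : ℝ) ≤ (1 / 2) ^ N)]
  induction N with
  | zero => simp
  | succ N ih =>
    rw [Finset.sum_range_succ]
    set b : ℝ := (1 / 2) ^ N with hb
    have hb0 : 0 < b := by positivity
    have hb1 : b ≤ 1 := pow_le_one₀ (by norm_num) (by norm_num)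
    have ha : (1 / 2 : ℝ) ^ (N + 1) = b / 2 := by rw [pow_succ]; ring
    have hder : ∀ x ∈ Set.Icc (b / 2) b, HasDerivAt (entropyPrimitive F)
        (Real.sqrt 2 * Real.sqrt (Real.log (F / x))) x := fun x hx =>
      hasDerivAt_entropyPrimitive (by linarith [hx.1]) (by linarith [hx.2])
    obtain ⟨c, hc, hslope⟩ := exists_hasDerivAt_eq_slope (entropyPrimitive F) _
      (by linarith : b / 2 < b) (fun x hx => (hder x hx).continuousAt.continuousWithinAt)
      fun x hx => hder x (Set.Ioo_subset_Icc_self hx)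
    have hc0 : 0 < c := by linarith [hc.1]
    have hle : Real.sqrt (2 * Real.log (F * 2 ^ N)) ≤
        Real.sqrt 2 * Real.sqrt (Real.log (F / c)) := by
      rw [Real.sqrt_mul (by norm_num)]
      gcongr
      rw [le_div_iff₀ hc0]
      have h1 : (2 : ℝ) ^ N * b = 1 := by
        rw [hb, ← mul_pow]
        norm_num
      calc F * 2 ^ N * c ≤ F * 2 ^ N * b := by gcongr; exact hc.2.le
        _ = F := by rw [mul_assoc, h1, mul_one]
    rw [ha]
    rw [hslope, le_div_iff₀ (by linarith)] at hle
    linarith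

/-! ### Powers -/

theorem rpow_quarter_pow {x : ℝ} (hx : 0 ≤ x) (k : ℕ) :
    (x ^ ((1 : ℝ) / 4)) ^ k = x ^ ((k : ℝ) / 4) := by
  rw [← Real.rpow_natCast, ← Real.rpow_mul hx]
  congr 1
  ring

theorem sqrt_eq_of_eq_sq {x y : ℝ} (hy : 0 ≤ y) (h : x = y ^ 2) : Real.sqrt x = y := by
  rw [h, Real.sqrt_sq hy]

theorem sum_half_pow_le (N : ℕ) : ∑ j ∈ Finset.range N, (1 / 2 : ℝ) ^ (N - 1 - j) ≤ 2 := by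
  rw [Finset.sum_range_reflect fun j => (1 / 2 : ℝ) ^ j]
  have := summable_geometric_two.sum_le_tsum (Finset.range N) fun _ _ => by positivity
  rwa [tsum_geometric_two] at this

/-! ### The three regimes -/

/-- At scale `γ / 4^j` the entropy root grows like `2^j`, so the terms decay like `2^(-j)`. The
logarithm's argument is exactly `(F 2^j)²`, the `56 = 4 · 14` in `F²` coming from the exponent `j +
1`. The constant is `160 = 2 · 40 · 2`: chaining, each term, and the primitive at 1. -/
theorem chainingSum_le_of_one {C m : ℕ} (hC : 1 ≤ C) (hm : 0 < m) {M K γ : ℝ} (hM : 1 ≤ M)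
    (hK : 0 < K) (hγ : 0 < γ) (hγ1 : γ ≤ 1) (N : ℕ) :
    2 * ∑ j ∈ Finset.range N, (γ / 4 ^ (j + 1) + γ / 4 ^ j) *
        Real.sqrt (C * (20 * (K * (96 * Real.sqrt C / (γ / 4 ^ (j + 1))) ^ 1) *
          Real.log (14 * M * Real.sqrt C / (γ / 4 ^ (j + 1)))) / m) ≤
      160 * Real.sqrt (30 * K * γ / m) * (C : ℝ) ^ ((3 : ℝ) / 4) *
          (Real.sqrt (Real.log (boundF M γ C) / 2) +
            Real.sqrt (Real.pi / 8) * boundF M γ C *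
              (1 - erf (Real.sqrt (Real.log (boundF M γ C))))) := by
  have hm' : (0 : ℝ) < m := by exact_mod_cast hm
  have hC1 : (1 : ℝ) ≤ C := by exact_mod_cast hC
  have hC0 : (0 : ℝ) ≤ C := by linarith
  set q : ℝ := (C : ℝ) ^ ((1 : ℝ) / 4) with hq
  have hq1 : 1 ≤ q := Real.one_le_rpow hC1 (by norm_num)
  have hq2 : Real.sqrt C = q ^ 2 := by
    rw [hq, rpow_quarter_pow hC0, Real.sqrt_eq_rpow]
    norm_num
  have hq3 : (C : ℝ) ^ ((3 : ℝ) / 4) = q ^ 3 := by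
    rw [hq, rpow_quarter_pow hC0]
    norm_num
  have hq4 : (C : ℝ) = q ^ 4 := by
    rw [hq, rpow_quarter_pow hC0]
    norm_num
  set F := boundF M γ C with hF
  have hF2 : F ^ 2 = 56 * M / γ * q ^ 2 := by
    rw [hF, boundF, mul_pow, mul_pow, Real.sq_sqrt (by positivity), ← hq]
    ring
  have hF0 : 0 ≤ F := by rw [hF, boundF]; positivity
  have hF1 : 1 < F := by
    have h1 : 56 ≤ 56 * M / γ := by
      rw [le_div_iff₀ hγ]
      nlinarith
    have h2 : 1 ≤ q ^ 2 := one_le_pow₀ hq1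
    nlinarith
  have hterm : ∀ j ∈ Finset.range N, (γ / 4 ^ (j + 1) + γ / 4 ^ j) *
        Real.sqrt (C * (20 * (K * (96 * Real.sqrt C / (γ / 4 ^ (j + 1))) ^ 1) *
          Real.log (14 * M * Real.sqrt C / (γ / 4 ^ (j + 1)))) / m) =
      40 * Real.sqrt (30 * K * γ / m) * (C : ℝ) ^ ((3 : ℝ) / 4) *
        ((1 / 2 : ℝ) ^ (j + 1) * Real.sqrt (2 * Real.log (F * 2 ^ j))) := by
    intro j _
    have harg : Real.log (14 * M * Real.sqrt C / (γ / 4 ^ (j + 1))) =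
        2 * Real.log (F * 2 ^ j) := by
      have h1 : 14 * M * Real.sqrt C / (γ / 4 ^ (j + 1)) = (F * 2 ^ j) ^ 2 := by
        rw [mul_pow, hF2, hq2, ← pow_mul, mul_comm j 2, pow_mul, pow_succ]
        field_simp
        norm_num
        ring
      rw [h1, Real.log_pow]
      norm_num
    have hlog : 0 ≤ Real.log (F * 2 ^ j) :=
      Real.log_nonneg (one_le_mul_of_one_le_of_one_le hF1.le (one_le_pow₀ (by norm_num)))
    rw [harg, hq3, hq2, pow_one]
    have h4 : (4 : ℝ) ^ (j + 1) = (2 ^ (j + 1)) ^ 2 := by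
      rw [← pow_mul, mul_comm, pow_mul]
      norm_num
    have hsq : Real.sqrt (C * (20 * (K * (96 * q ^ 2 / (γ / 4 ^ (j + 1)))) *
          (2 * Real.log (F * 2 ^ j))) / m) =
        8 / γ * 2 ^ (j + 1) * q ^ 3 * Real.sqrt (30 * K * γ / m) *
          Real.sqrt (2 * Real.log (F * 2 ^ j)) := by
      refine sqrt_eq_of_eq_sq (by positivity) ?_
      rw [mul_pow, mul_pow, Real.sq_sqrt (by positivity), Real.sq_sqrt (by positivity), hq4, h4]
      field_simp
      ring
    rw [hsq]
    have h4' : (4 : ℝ) ^ j = (2 ^ j) ^ 2 := by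
      rw [← pow_mul, mul_comm, pow_mul]
      norm_num
    rw [h4, h4', one_div, inv_pow, pow_succ (2 : ℝ) j]
    field_simp
    ring
  rw [Finset.sum_congr rfl hterm, ← Finset.mul_sum]
  have hsum := sum_sqrt_log_le hF1 N
  have hprim : entropyPrimitive F 1 = 2 * (Real.sqrt (Real.log F / 2) +
      Real.sqrt (Real.pi / 8) * F * (1 - erf (Real.sqrt (Real.log F)))) := by
    have hl := Real.log_nonneg hF1.le
    have h1 : Real.sqrt (Real.pi / 2) = 2 * Real.sqrt (Real.pi / 8) := by
      refine sqrt_eq_of_eq_sq (by positivity) ?_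
      rw [mul_pow, Real.sq_sqrt (by positivity)]
      ring
    have h2 : Real.sqrt 2 * Real.sqrt (Real.log F) = 2 * Real.sqrt (Real.log F / 2) := by
      rw [← Real.sqrt_mul (by norm_num)]
      refine sqrt_eq_of_eq_sq (by positivity) ?_
      rw [mul_pow, Real.sq_sqrt (by positivity)]
      ring
    rw [entropyPrimitive, div_one, h1, h2]
    ring
  rw [hprim] at hsum
  calc _ ≤ 2 * (40 * Real.sqrt (30 * K * γ / m) * (C : ℝ) ^ ((3 : ℝ) / 4) *
        (2 * (Real.sqrt (Real.log F / 2) +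
          Real.sqrt (Real.pi / 8) * F * (1 - erf (Real.sqrt (Real.log F)))))) := by gcongr
    _ = _ := by ring

/-- A chaining sum along a geometric sequence of scales, in terms of the smallest scale `c` and of
the ratio `a`. -/
theorem chainingSum_geometric_le {C m d : ℕ} (hC : 0 < C) (hm : 0 < m) {M K c a : ℝ}
    (hK : 0 < K) (hc : 0 < c) (ha : 1 ≤ a) {r : ℝ} (hr : 0 ≤ r) (had : a ^ d * r ^ 2 = a ^ 2)
    (N : ℕ) (hN : ∀ j < N, c * a ^ (N - (j + 1)) ≤ 14 * M * Real.sqrt C) :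
    2 * ∑ j ∈ Finset.range N, (c * a ^ (N - (j + 1)) + c * a ^ (N - j)) *
        Real.sqrt (C * (20 * (K * (96 * Real.sqrt C / (c * a ^ (N - (j + 1)))) ^ d) *
          Real.log (14 * M * Real.sqrt C / (c * a ^ (N - (j + 1))))) / m) ≤
      4 * (1 + a) * c * Real.sqrt (5 * K) * Real.sqrt (C * (96 * Real.sqrt C / c) ^ d / m) *
        Real.sqrt (Real.log (14 * M * Real.sqrt C / c)) *
        ∑ j ∈ Finset.range N, r ^ (N - 1 - j) := by
  have hm' : (0 : ℝ) < m := by exact_mod_cast hm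
  have hC' : (0 : ℝ) < C := by exact_mod_cast hC
  have ha0 : 0 < a := by linarith
  rw [Finset.mul_sum, Finset.mul_sum]
  refine Finset.sum_le_sum fun j hj => ?_
  have hj := Finset.mem_range.1 hj
  have hi := hN j hj
  obtain ⟨i, hi1, hi2, hi3⟩ : ∃ i, N - (j + 1) = i ∧ N - j = i + 1 ∧ N - 1 - j = i :=
    ⟨N - (j + 1), rfl, by lia, by lia⟩
  rw [hi1] at hi
  rw [hi1, hi2, hi3]
  set b := a ^ i with hb
  have hb1 : 1 ≤ b := one_le_pow₀ ha
  have hb0 : 0 < b := by linarith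
  -- The relation between `a` and `r` says `r = a^(1 - d/2)`, so `r ^ i = b^(1 - d/2)` is the
  -- dependence of the term on its scale `c b`.
  have hbd : b ^ d * (r ^ i) ^ 2 = b ^ 2 := by
    rw [hb, ← pow_mul, ← pow_mul, ← pow_mul, mul_comm i d, mul_comm i 2, pow_mul, pow_mul, pow_mul,
      ← mul_pow, had]
  have harg1 : 1 ≤ 14 * M * Real.sqrt C / (c * b) := (one_le_div (by positivity)).2 hi
  have hcb : c ≤ c * b := le_mul_of_one_le_right hc.le hb1
  have hnum : 0 < 14 * M * Real.sqrt C := lt_of_lt_of_le (by positivity) hi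
  have hlog : 0 ≤ Real.log (14 * M * Real.sqrt C / (c * b)) := Real.log_nonneg harg1
  have hlog' : Real.log (14 * M * Real.sqrt C / (c * b)) ≤
      Real.log (14 * M * Real.sqrt C / c) := by
    refine Real.log_le_log (by linarith) ?_
    gcongr
  have hsq : Real.sqrt (C * (20 * (K * (96 * Real.sqrt C / (c * b)) ^ d) *
          Real.log (14 * M * Real.sqrt C / (c * b))) / m) =
      2 * (r ^ i / b) * Real.sqrt (5 * K) * Real.sqrt (C * (96 * Real.sqrt C / c) ^ d / m) *
        Real.sqrt (Real.log (14 * M * Real.sqrt C / (c * b))) := by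
    refine sqrt_eq_of_eq_sq (by positivity) ?_
    rw [mul_pow, mul_pow, mul_pow, Real.sq_sqrt (by positivity), Real.sq_sqrt (by positivity),
      Real.sq_sqrt (by positivity)]
    have h1 : (96 * Real.sqrt C / (c * b)) ^ d = (96 * Real.sqrt C / c) ^ d * (r ^ i / b) ^ 2 := by
      rw [← div_div, div_pow _ b, div_pow (r ^ i), div_eq_mul_inv]
      congr 1
      rw [← hbd]
      have : r ^ i ≠ 0 := by
        intro h0
        rw [h0, zero_pow two_ne_zero, mul_zero] at hbd
        exact (pow_pos hb0 2).ne hbd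
      field_simp
    rw [h1, mul_pow]
    ring
  rw [hsq, pow_succ]
  calc 2 * ((c * b + c * (b * a)) * (2 * (r ^ i / b) * Real.sqrt (5 * K) *
        Real.sqrt (C * (96 * Real.sqrt C / c) ^ d / m) *
        Real.sqrt (Real.log (14 * M * Real.sqrt C / (c * b)))))
      = 4 * (1 + a) * c * Real.sqrt (5 * K) * Real.sqrt (C * (96 * Real.sqrt C / c) ^ d / m) *
        Real.sqrt (Real.log (14 * M * Real.sqrt C / (c * b))) * r ^ i := by
        field_simp
        ring
    _ ≤ _ := by gcongr

theorem antitone_geometric {c a : ℝ} (hc : 0 < c) (ha : 1 ≤ a) (N : ℕ) :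
    Antitone fun j => c * a ^ (N - j) := fun i j hij => by
  have : N - j ≤ N - i := by lia
  dsimp only
  gcongr

theorem rademacherComplexity_le_of_one {X : Type*} [MeasurableSpace X] {C m : ℕ}
    (hC : 2 ≤ C) (hm : 0 < m) (P : Measure (X × Fin C)) [IsProbabilityMeasure P] {M : ℝ}
    (hM1 : 1 ≤ M) (G : Fin C → Set (X → ℝ)) (hM : ∀ k, ∀ f ∈ G k, ∀ x, f x ∈ Set.Icc (-M) M)
    {K : ℝ} (hK : 0 < K)
    (hdim : ∀ ε : ℝ, 0 < ε → ε ≤ M →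
      (((⨆ k : Fin C, fatDim (Set.Icc (-M) M) (G k) ε) : ℕ∞) : ℝ≥0∞)
        ≤ ENNReal.ofReal (K * (1 / ε ^ 1)))
    {γ : ℝ} (hγ : 0 < γ) (hγ1 : γ ≤ 1) :
    rademacherComplexity P m (squashedMarginClass G γ) ≤
      ((160 * Real.sqrt (30 * K * γ / m) * (C : ℝ) ^ ((3 : ℝ) / 4) *
          (Real.sqrt (Real.log (boundF M γ C) / 2) +
            Real.sqrt (Real.pi / 8) * boundF M γ C *
              (1 - erf (Real.sqrt (Real.log (boundF M γ C))))) : ℝ) : EReal) := by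
  have hsC : 1 ≤ Real.sqrt C := Real.one_le_sqrt.2 (by exact_mod_cast (by lia : 1 ≤ C))
  set B : ℝ := 160 * Real.sqrt (30 * K * γ / m) * (C : ℝ) ^ ((3 : ℝ) / 4) *
          (Real.sqrt (Real.log (boundF M γ C) / 2) +
            Real.sqrt (Real.pi / 8) * boundF M γ C *
              (1 - erf (Real.sqrt (Real.log (boundF M γ C))))) with hB
  have hle : ∀ N : ℕ, rademacherComplexity P m (squashedMarginClass G γ) ≤
      ((γ / 4 ^ N + B : ℝ) : EReal) := by
    intro N
    have hanti : Antitone fun j : ℕ => γ / 4 ^ j := fun i j hij => by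
      dsimp only
      gcongr
      norm_num
    refine (rademacherComplexity_squashedMarginClass_le hC hm P G hM hK hdim hγ N
      (fun j => γ / 4 ^ j) (fun j => by positivity) (by simp) hanti fun j _ => ?_).trans ?_
    · calc γ / 4 ^ (j + 1) ≤ γ / 4 ^ 0 := hanti (Nat.zero_le _)
        _ = γ := by simp
        _ ≤ 1 * 1 := by linarith
        _ ≤ Real.sqrt C * M := by gcongr
    · rw [EReal.coe_le_coe_iff]
      gcongr
      exact chainingSum_le_of_one (by lia) hm hM1 hK hγ hγ1 N
  -- The chaining sum is bounded uniformly in the depth, so the approximation error can be sent to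
  -- 0.
  have hlim : Tendsto (fun N : ℕ => γ / 4 ^ N + B) atTop (𝓝 B) := by
    have h1 := (tendsto_pow_atTop_nhds_zero_of_lt_one (by norm_num : (0 : ℝ) ≤ 1 / 4)
      (by norm_num)).const_mul γ
    have h2 := h1.add_const B
    rw [mul_zero, zero_add] at h2
    refine h2.congr fun N => ?_
    rw [one_div, inv_pow, div_eq_mul_inv]
  exact ge_of_tendsto' ((continuous_coe_real_ereal.tendsto B).comp hlim) hle

theorem rademacherComplexity_le_of_two {X : Type*} [MeasurableSpace X] {C m : ℕ}
    (hC : 2 ≤ C) (hm : C < m) (P : Measure (X × Fin C)) [IsProbabilityMeasure P] {M : ℝ}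
    (hM1 : 1 ≤ M) (G : Fin C → Set (X → ℝ)) (hM : ∀ k, ∀ f ∈ G k, ∀ x, f x ∈ Set.Icc (-M) M)
    {K : ℝ} (hK : 0 < K)
    (hdim : ∀ ε : ℝ, 0 < ε → ε ≤ M →
      (((⨆ k : Fin C, fatDim (Set.Icc (-M) M) (G k) ε) : ℕ∞) : ℝ≥0∞)
        ≤ ENNReal.ofReal (K * (1 / ε ^ 2)))
    {γ : ℝ} (hγ : 0 < γ) (hγ1 : γ ≤ 1) :
    rademacherComplexity P m (squashedMarginClass G γ) ≤
      ((γ * (C : ℝ) ^ ((3 : ℝ) / 4) / Real.sqrt m +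
          1152 * Real.sqrt (5 * K / m) * C *
            (⌈(1 / 2 : ℝ) * Real.logb 2 ((m : ℝ) / C)⌉ : ℝ) *
            Real.sqrt (Real.log (14 * M * Real.sqrt m / (γ * (C : ℝ) ^ ((1 : ℝ) / 4)))) : ℝ) :
          EReal) := by
  have hC1 : (1 : ℝ) ≤ C := by exact_mod_cast (by lia : 1 ≤ C)
  have hC0 : (0 : ℝ) < C := by linarith
  have hm' : (0 : ℝ) < m := by exact_mod_cast (by lia : 0 < m)
  have hmC : 1 < (m : ℝ) / C := (one_lt_div hC0).2 (by exact_mod_cast hm)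
  set q : ℝ := (C : ℝ) ^ ((1 : ℝ) / 4) with hq
  have hq1 : 1 ≤ q := Real.one_le_rpow hC1 (by norm_num)
  have hq2 : Real.sqrt C = q ^ 2 := by
    rw [hq, rpow_quarter_pow hC0.le, Real.sqrt_eq_rpow]
    norm_num
  have hq3 : (C : ℝ) ^ ((3 : ℝ) / 4) = q ^ 3 := by
    rw [hq, rpow_quarter_pow hC0.le]
    norm_num
  have hq4 : (C : ℝ) = q ^ 4 := by
    rw [hq, rpow_quarter_pow hC0.le]
    norm_num
  set t : ℝ := (1 / 2 : ℝ) * Real.logb 2 ((m : ℝ) / C) with ht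
  have ht0 : 0 < t := mul_pos (by norm_num) (Real.logb_pos (by norm_num) hmC)
  have h2t : (2 : ℝ) ^ t = Real.sqrt m / q ^ 2 := by
    rw [ht, mul_comm, Real.rpow_mul (by norm_num), Real.rpow_logb (by norm_num) (by norm_num)
      (by positivity), ← Real.sqrt_eq_rpow, Real.sqrt_div hm'.le, hq2]
  obtain ⟨N, hN⟩ : ∃ N : ℕ, ⌈t⌉ = (N : ℤ) :=
    Int.eq_ofNat_of_zero_le (Int.ceil_nonneg ht0.le)
  have hNt : t ≤ N := by
    have := Int.le_ceil t
    rw [hN] at this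
    exact_mod_cast this
  have hNt' : (N : ℝ) < t + 1 := by
    have := Int.ceil_lt_add_one t
    rw [hN] at this
    exact_mod_cast this
  have hsm : 0 < Real.sqrt m := Real.sqrt_pos.2 hm'
  -- The finest scale is the first term of the bound. Since `c 2^t = γ q`, depth `⌈t⌉` reaches a
  -- scale of at least `γ`, and each of the `N` links contributes equally (`a = 2`, `r = 1`).
  set c : ℝ := γ * q ^ 3 / Real.sqrt m with hc
  have hc0 : 0 < c := by positivity
  clear_value c
  have hct : c * 2 ^ t = γ * q := by
    rw [h2t, hc]
    field_simp
  have hhN : ∀ j < N, c * 2 ^ (N - (j + 1)) ≤ Real.sqrt C * M := by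
    intro j hj
    have h1 : (2 : ℝ) ^ (N - (j + 1)) ≤ 2 ^ t := by
      rw [← Real.rpow_natCast]
      refine Real.rpow_le_rpow_of_exponent_le (by norm_num) ?_
      rw [Nat.cast_sub (by lia)]
      push_cast
      have : (0 : ℝ) ≤ j := Nat.cast_nonneg j
      linarith
    calc c * 2 ^ (N - (j + 1)) ≤ c * 2 ^ t := by gcongr
      _ = γ * q := hct
      _ ≤ q * q := by gcongr; linarith
      _ = Real.sqrt C * 1 := by rw [hq2]; ring
      _ ≤ Real.sqrt C * M := by gcongr
  refine (rademacherComplexity_squashedMarginClass_le hC (by lia) P G hM hK hdim hγ N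
    (fun j => c * 2 ^ (N - j)) (fun j => by positivity) ?_
    (antitone_geometric hc0 (by norm_num) N) hhN).trans ?_
  · calc γ ≤ γ * q := le_mul_of_one_le_right hγ.le hq1
      _ = c * 2 ^ t := hct.symm
      _ ≤ c * 2 ^ (N - 0) := by
        rw [Nat.sub_zero, ← Real.rpow_natCast]
        gcongr
        norm_num
  · rw [EReal.coe_le_coe_iff]
    have hsum := chainingSum_geometric_le (d := 2) (M := M) (r := 1) (by lia : 0 < C)
      (by lia : 0 < m) hK hc0 (by norm_num : (1 : ℝ) ≤ 2) (by norm_num) (by norm_num) N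
      fun j hj => (hhN j hj).trans (by nlinarith [Real.sqrt_nonneg (C : ℝ)])
    have h1 : Real.sqrt (C * (96 * Real.sqrt C / c) ^ 2 / m) = 96 * q ^ 4 / (c * Real.sqrt m) := by
      refine sqrt_eq_of_eq_sq (by positivity) ?_
      rw [hq2, hq4, div_pow, div_pow, mul_pow c, Real.sq_sqrt hm'.le]
      field_simp
    have h2 : 14 * M * Real.sqrt C / c = 14 * M * Real.sqrt m / (γ * q) := by
      rw [hq2, hc]
      field_simp
    have h3 : Real.sqrt (5 * K / m) = Real.sqrt (5 * K) / Real.sqrt m :=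
      Real.sqrt_div (by positivity) _
    rw [hN, h3, hq3, ← hc, Nat.sub_self, pow_zero, mul_one]
    refine add_le_add le_rfl (hsum.trans_eq ?_)
    rw [h1, h2]
    simp only [one_pow, Finset.sum_const, Finset.card_range, nsmul_eq_mul, mul_one]
    rw [hq4]
    push_cast
    field_simp
    ring

theorem rademacherComplexity_le_of_two_lt {X : Type*} [MeasurableSpace X] {C m : ℕ}
    (hC : 2 ≤ C) (hm : C < m) (P : Measure (X × Fin C)) [IsProbabilityMeasure P] {M : ℝ}
    (hM1 : 1 ≤ M) (G : Fin C → Set (X → ℝ)) (hM : ∀ k, ∀ f ∈ G k, ∀ x, f x ∈ Set.Icc (-M) M)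
    {d : ℕ} (hd : 2 < d) {K : ℝ} (hK : 0 < K)
    (hdim : ∀ ε : ℝ, 0 < ε → ε ≤ M →
      (((⨆ k : Fin C, fatDim (Set.Icc (-M) M) (G k) ε) : ℕ∞) : ℝ≥0∞)
        ≤ ENNReal.ofReal (K * (1 / ε ^ d)))
    {γ : ℝ} (hγ : 0 < γ) (hγ1 : γ ≤ 1) :
    rademacherComplexity P m (squashedMarginClass G γ) ≤
      ((Real.sqrt C *
          (γ * ((C : ℝ) / m) ^ ((1 : ℝ) / d) +
            8 * (96 : ℝ) ^ ((d : ℝ) / 2) * ((2 : ℝ) ^ ((2 : ℝ) / ((d : ℝ) - 2)) + 1) *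
              γ ^ (1 - (d : ℝ) / 2) * Real.sqrt (5 * K) * ((C : ℝ) / m) ^ ((1 : ℝ) / d) *
              Real.sqrt (Real.log (14 * M / γ * ((m : ℝ) / C) ^ ((1 : ℝ) / d)))) : ℝ) :
          EReal) := by
  have hC1 : (1 : ℝ) ≤ C := by exact_mod_cast (by lia : 1 ≤ C)
  have hC0 : (0 : ℝ) < C := by linarith
  have hm' : (0 : ℝ) < m := by exact_mod_cast (by lia : 0 < m)
  have hmC : 1 < (m : ℝ) / C := (one_lt_div hC0).2 (by exact_mod_cast hm)
  have hd2 : (2 : ℝ) < d := by exact_mod_cast hd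
  have hsC : 1 ≤ Real.sqrt C := Real.one_le_sqrt.2 hC1
  set a : ℝ := (2 : ℝ) ^ ((2 : ℝ) / ((d : ℝ) - 2)) with ha
  have ha1 : 1 < a := Real.one_lt_rpow (by norm_num) (div_pos (by norm_num) (by linarith))
  have ha0 : 0 < a := by linarith
  -- The ratio `a` is chosen so that the terms are halved at each coarser scale, which gives a
  -- geometric sum of at most 2.
  have had : a ^ d * (1 / 2 : ℝ) ^ 2 = a ^ 2 := by
    have h1 : a ^ (d - 2) = 4 := by
      rw [ha, ← Real.rpow_natCast, ← Real.rpow_mul (by norm_num), Nat.cast_sub hd.le,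
        Nat.cast_ofNat, div_mul_cancel₀ _ (by linarith)]
      norm_num
    have h2 : a ^ d = a ^ (d - 2) * a ^ 2 := by rw [← pow_add, Nat.sub_add_cancel hd.le]
    rw [h2, h1]
    ring
  set ρ : ℝ := ((C : ℝ) / m) ^ ((1 : ℝ) / d) with hρ
  have hρ0 : 0 < ρ := by positivity
  have hρd : ρ ^ d = C / m := by
    rw [hρ, ← Real.rpow_natCast, ← Real.rpow_mul (by positivity), one_div_mul_cancel (by linarith),
      Real.rpow_one]
  have hρinv : ((m : ℝ) / C) ^ ((1 : ℝ) / d) = ρ⁻¹ := by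
    rw [hρ, ← Real.inv_rpow (by positivity), inv_div]
  have hρ1 : 1 < ρ⁻¹ := by
    rw [← hρinv]
    exact Real.one_lt_rpow hmC (by positivity)
  -- The least such depth: `c a^N` covers the diameter `γ`, while all finer scales stay below `√C
  -- γ`, as the entropy bound requires.
  obtain ⟨N, hN1, hN2⟩ : ∃ N : ℕ, ρ⁻¹ ≤ a ^ N ∧ ∀ i < N, a ^ i < ρ⁻¹ := by
    classical
    have hex : ∃ N : ℕ, ρ⁻¹ ≤ a ^ N := by
      obtain ⟨N, hN⟩ := pow_unbounded_of_one_lt ρ⁻¹ ha1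
      exact ⟨N, hN.le⟩
    exact ⟨Nat.find hex, Nat.find_spec hex, fun i hi => not_le.1 (Nat.find_min hex hi)⟩
  set c : ℝ := Real.sqrt C * γ * ρ with hc
  have hc0 : 0 < c := by positivity
  have hcρ : c * ρ⁻¹ = Real.sqrt C * γ := by
    rw [hc]
    field_simp
  have hhN : ∀ j < N, c * a ^ (N - (j + 1)) ≤ Real.sqrt C * M := by
    intro j hj
    calc c * a ^ (N - (j + 1)) ≤ c * ρ⁻¹ := by
          gcongr
          exact (hN2 _ (by lia)).le
      _ = Real.sqrt C * γ := hcρ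
      _ ≤ Real.sqrt C * M := by gcongr; linarith
  refine (rademacherComplexity_squashedMarginClass_le hC (by lia) P G hM hK hdim hγ N
    (fun j => c * a ^ (N - j)) (fun j => by positivity) ?_
    (antitone_geometric hc0 ha1.le N) hhN).trans ?_
  · calc γ ≤ Real.sqrt C * γ := le_mul_of_one_le_left hγ.le hsC
      _ = c * ρ⁻¹ := hcρ.symm
      _ ≤ c * a ^ (N - 0) := by
        rw [Nat.sub_zero]
        gcongr
  · rw [EReal.coe_le_coe_iff]
    have hsum := chainingSum_geometric_le (d := d) (M := M) (r := 1 / 2) (by lia : 0 < C)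
      (by lia : 0 < m) hK hc0 ha1.le (by norm_num) had N
      fun j hj => (hhN j hj).trans (by nlinarith [Real.sqrt_nonneg (C : ℝ)])
    have hγd : γ ^ (1 - (d : ℝ) / 2) = γ * γ ^ (-((d : ℝ) / 2)) := by
      rw [sub_eq_add_neg, Real.rpow_add hγ, Real.rpow_one]
    have hpow : ∀ x : ℝ, 0 < x → (x ^ ((d : ℝ) / 2)) ^ 2 = x ^ d := by
      intro x hx
      rw [← Real.rpow_natCast, ← Real.rpow_mul hx.le, ← Real.rpow_natCast x d]
      congr 1
      push_cast
      ring
    have h1 : Real.sqrt (C * (96 * Real.sqrt C / c) ^ d / m) =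
        (96 : ℝ) ^ ((d : ℝ) / 2) * γ ^ (-((d : ℝ) / 2)) := by
      refine sqrt_eq_of_eq_sq (by positivity) ?_
      have h3 : 96 * Real.sqrt C / c = 96 / γ * ρ⁻¹ := by
        rw [hc]
        field_simp
      rw [h3, mul_pow, mul_pow, inv_pow, hρd, Real.rpow_neg hγ.le, inv_pow, hpow _ (by norm_num),
        hpow _ hγ, div_pow]
      field_simp
    have h2 : 14 * M * Real.sqrt C / c = 14 * M / γ * ρ⁻¹ := by
      rw [hc]
      field_simp
    rw [hρinv, hγd, Nat.sub_self, pow_zero, mul_one]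
    rw [h1, h2] at hsum
    have hgeo := sum_half_pow_le N
    calc _ ≤ c + 4 * (1 + a) * c * Real.sqrt (5 * K) *
          ((96 : ℝ) ^ ((d : ℝ) / 2) * γ ^ (-((d : ℝ) / 2))) *
          Real.sqrt (Real.log (14 * M / γ * ρ⁻¹)) * 2 := by
          refine add_le_add le_rfl (hsum.trans ?_)
          gcongr
      _ = _ := by
          rw [hc]
          ring

end MarginClassifier

theorem theorem5 {X : Type*} [MeasurableSpace X] (C m : ℕ) (hC : 3 ≤ C) (hm : C < m)
    (P : Measure (X × Fin C)) [IsProbabilityMeasure P]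
    (M : ℝ) (G : Fin C → Set (X → ℝ)) (hG : MarginClassifier.IsMarginClass M G)
    (d : ℕ) (hd : 1 ≤ d) (K : ℝ) (hK : 0 < K)
    (hdim : ∀ ε : ℝ, 0 < ε → ε ≤ M →
      (((⨆ k : Fin C, MarginClassifier.fatDim (Set.Icc (-M) M) (G k) ε) : ℕ∞) : ℝ≥0∞)
        ≤ ENNReal.ofReal (K * (1 / ε ^ d)))
    (γ : ℝ) (hγ : 0 < γ) (hγ1 : γ ≤ 1) :
    (d = 1 →
      MarginClassifier.rademacherComplexity P m (MarginClassifier.squashedMarginClass G γ) ≤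
        ((160 * Real.sqrt (30 * K * γ / m) * (C : ℝ) ^ ((3 : ℝ) / 4) *
          (Real.sqrt (Real.log (MarginClassifier.boundF M γ C) / 2) +
            Real.sqrt (Real.pi / 8) * MarginClassifier.boundF M γ C *
              (1 - MarginClassifier.erf
                (Real.sqrt (Real.log (MarginClassifier.boundF M γ C))))) : ℝ) : EReal)) ∧
    (d = 2 →
      MarginClassifier.rademacherComplexity P m (MarginClassifier.squashedMarginClass G γ) ≤
        ((γ * (C : ℝ) ^ ((3 : ℝ) / 4) / Real.sqrt m +
          1152 * Real.sqrt (5 * K / m) * C *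
            (⌈(1 / 2 : ℝ) * Real.logb 2 ((m : ℝ) / C)⌉ : ℝ) *
            Real.sqrt (Real.log (14 * M * Real.sqrt m / (γ * (C : ℝ) ^ ((1 : ℝ) / 4)))) : ℝ) :
          EReal)) ∧
    (2 < d →
      MarginClassifier.rademacherComplexity P m (MarginClassifier.squashedMarginClass G γ) ≤
        ((Real.sqrt C *
          (γ * ((C : ℝ) / m) ^ ((1 : ℝ) / d) +
            8 * (96 : ℝ) ^ ((d : ℝ) / 2) * ((2 : ℝ) ^ ((2 : ℝ) / ((d : ℝ) - 2)) + 1) *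
              γ ^ (1 - (d : ℝ) / 2) * Real.sqrt (5 * K) * ((C : ℝ) / m) ^ ((1 : ℝ) / d) *
              Real.sqrt (Real.log (14 * M / γ * ((m : ℝ) / C) ^ ((1 : ℝ) / d)))) : ℝ) :
          EReal)) := by
  refine ⟨?_, ?_, fun hd2 => ?_⟩
  · rintro rfl
    exact MarginClassifier.rademacherComplexity_le_of_one (by lia) (by lia) P hG.one_le G hG.mem_Icc
      hK hdim hγ hγ1
  · rintro rfl
    exact MarginClassifier.rademacherComplexity_le_of_two (by lia) hm P hG.one_le G hG.mem_Icc
      hK hdim hγ hγ1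
  · exact MarginClassifier.rademacherComplexity_le_of_two_lt (by lia) hm P hG.one_le G hG.mem_Icc
      hd2 hK hdim hγ hγ1
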